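/- **Setting.** Let $A\ge 2$, $T\ge 1$, let $\Delta_A$ be the probability simplex in $\mathbb R^A$, and let an oblivious adversary fix losses $\ell_1,\dots,\ell_T\in[0,1]^A$. A bandit learner plays in round $t$ a mixed strategy $x_t\in\Delta_A$ that depends on the past arms and their observed losses, draws $A_t\sim x_t$ and, as there is no delay ($D=\sum_t d_t=0$), observes $\ell_t(A_t)$ at the end of round $t$. For $x\in\Delta_A$ put $\mathcal R_T(x)=\mathbb E\big[\sum_{t=1}^T\langle \ell_t,x_t-x\rangle\big]$, and $\mathcal R_T=\max_{x\in\Delta_A}\mathcal R_T(x)$. The safe baseline is $x^c\in\Delta_A$ with $x^c(a)\ge\delta$ for all arms $a$, where $\delta\in(0,1/A]$. **Algorithm.** Prudent-Banker with regularizer $\Psi(x)=\sum_a x(a)\log x(a)$, initial point $x_0=\mathbf 1/A$ and constants $C_1=\log A$, $C_2=1/\delta$ (so $C_1C_2=\log A/\delta$) is the following. Let $\nabla\bar\Psi^*$ be the gradient of $y\mapsto\max_{x\in\Delta_A}(\langle y,x\rangle-\Psi(x))$, let $\widehat D=1$, $\widehat R=\sqrt{C_1C_2}\,\big(3\sqrt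 T+7\sqrt{2\widehat D\ln(\widehat D+1)}\big)$ and $\widehat\xi=(\sqrt{8\widehat D+1}-1)/\delta$. Start with phase $k=1$, $\mathrm{start}=1$. In phase $k$ put $\alpha=\min\{2^{k-1}/\widehat R,1\}$. In round $t$: 1. Let $\sigma_t=\sqrt{C_2/C_1}\,\sqrt{t-\mathrm{start}+1}$, and set $v_t=b_t=\sigma_t$. For $u=\mathrm{start},\dots,t-1$ in turn, let $\sigma_{t,u}=\min\{v_u,b_t\}$ and subtract $\sigma_{t,u}$ from both $v_u$ and $b_t$. 2. Let $\hat x_t=\nabla\bar\Psi^*\big(\tfrac1{\sigma_t}\sum_{u}\sigma_{t,u}\nabla\Psi(z_u)+\tfrac{b_t}{\sigma_t}\nabla\Psi(x_0)\big)$, play $x_t=\alpha\hat x_t+(1-\alpha)x^c$, draw $A_t\sim x_t$, and observe $\ell_t(A_t)$. 3. Let $\hat\ell_t=\frac{\ell_t(A_t)}{x_t(A_t)}e_{A_t}$ and $z_t=\nabla\bar\Psi^*\big(\nabla\Psi(\hat x_t)-\hat\ell_t/\sigma_t\big)$. 4. If $\alpha<1$ and $\max_{x\in\Delta_A}\big\langle\sum_{u=\mathrm{start}}^t\hat\ell_u,\,x^c-x\big\rangle>2\widehat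 R+\widehat\xi$, begin a new phase: $k\leftarrow k+1$, $\mathrm{start}\leftarrow t+1$. (This is the delay-adaptive algorithm for the delay sequence $d_t=0$, where its delay-driven restarts never occur.) **Claim.** (a) There are universal constants $C$ and $p$ such that for all $A,T,\delta,x^c$ and all losses as above, Prudent-Banker is a valid learner ($x_t\in\Delta_A$) and $$\mathcal R_T\le C\,(1+\log(AT))^p\,\sqrt{\frac{T\log A}{\delta}},\qquad \mathcal R_T\le C\,(1+\log(AT))^p\,\sqrt{\frac{T}{\delta}},\qquad \mathcal R_T(x^c)\le C,$$ that is, $\mathcal R_T=\widetilde O(\sqrt{T\log A/\delta})$ and $\mathcal R_T(x^c)=O(1)$. (b) The first rate matches, up to logarithmic factors and lower-order terms, the safety-constrained lower bound of order $\sqrt{T/\delta}$: there are universal constants $c>0$ and $C'$ such that for all $A\ge2$, $T\ge1$, $\delta\in[\frac1{64T},\frac1A]$ and $\Lambda\ge0$ there is $x^c\in\Delta_A$ with $x^c(a)\ge\delta$ for all $a$ for which every learner that has $\mathcal R_T(x^c)\le\Lambda$ on all loss sequences in $[0,1]^A$ has, on some such loss sequence, $$\mathcal R_T\ge c\,\sqrt{\frac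 T\delta}-C'\Big(\sqrt\Lambda\,\delta^{-3/4}T^{1/4}+\Lambda\Big).$$ -/

import Mathlib

namespace SafeBandit

noncomputable section

/-! ## The bandit protocol

Rounds are numbered `0, …, T - 1` and arms are the elements of `Fin A`. -/

/-- A (randomized) learner: it maps the sequence of the (arm, loss of that arm) pairs of the past
rounds, oldest first, to the mixed strategy `x_t` of the next round. -/
abbrev Learner (A : ℕ) := List (Fin A × ℝ) → Fin A → ℝ

/-- The learner always plays a point of the probability simplex `Δ_A`. -/
def Learner.IsValid {A : ℕ} (L : Learner A) : Prop :=
  ∀ h, L h ∈ stdSimplex ℝ (Fin A)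

/-- The loss vectors of an oblivious adversary all lie in `[0,1]^A`. -/
def IsLossSeq {A T : ℕ} (loss : Fin T → Fin A → ℝ) : Prop :=
  ∀ t i, loss t i ∈ Set.Icc (0 : ℝ) 1

/-- The (arm, loss) pairs of the rounds before round `t`, if the arms `a` are drawn. -/
def history {A T : ℕ} (loss : Fin T → Fin A → ℝ) (a : Fin T → Fin A) (t : ℕ) :
    List (Fin A × ℝ) :=
  (List.ofFn fun s : Fin T => (a s, loss s (a s))).take t

/-- The probability that the learner draws the arms `a 0, …, a (T - 1)`: given the past, the arm
of round `t` is drawn from the mixed strategy `x_t`. -/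
def pathProb {A T : ℕ} (L : Learner A) (loss : Fin T → Fin A → ℝ) (a : Fin T → Fin A) : ℝ :=
  ∏ t : Fin T, L (history loss a t) (a t)

/-- `E[∑_t ⟨ℓ_t, x_t - x⟩]`, the pseudo-regret against the fixed strategy `x`. -/
def regretAgainst {A T : ℕ} (L : Learner A) (loss : Fin T → Fin A → ℝ) (x : Fin A → ℝ) : ℝ :=
  ∑ a : Fin T → Fin A, pathProb L loss a *
    ∑ t : Fin T, loss t ⬝ᵥ (L (history loss a t) - x)

/-- The adversarial regret `R_T = max_{x ∈ Δ_A} E[∑_t ⟨ℓ_t, x_t - x⟩]`. -/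
def regret {A T : ℕ} (L : Learner A) (loss : Fin T → Fin A → ℝ) : ℝ :=
  ⨆ x : stdSimplex ℝ (Fin A), regretAgainst L loss (x : Fin A → ℝ)

/-! ## Regularizers -/

/-- The gradient, as the vector of partial derivatives. -/
def grad {A : ℕ} (F : (Fin A → ℝ) → ℝ) (x : Fin A → ℝ) : Fin A → ℝ :=
  fun i => fderiv ℝ F x (Pi.single i 1)

/-- The convex conjugate of the restriction of `Ψ` to the simplex,
`y ↦ sup_{x ∈ Δ_A} (⟨y, x⟩ - Ψ x)`. -/
def simplexConj {A : ℕ} (Ψ : (Fin A → ℝ) → ℝ) (y : Fin A → ℝ) : ℝ :=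
  ⨆ x : stdSimplex ℝ (Fin A), (y ⬝ᵥ (x : Fin A → ℝ) - Ψ x)

/-- The negative entropy `∑_i x_i log x_i`. -/
def negEntropy {A : ℕ} (x : Fin A → ℝ) : ℝ :=
  ∑ i, x i * Real.log (x i)

/-! ## The Prudent-Banker algorithm -/

/-- The inputs of the algorithm: regularizer `Ψ`, its constants `C₁, C₂`, the comparator margin
`δ`, the horizon `T`, the safe baseline `x^c`, and the delays of the rounds (at round `t` the
algorithm only uses the delays of the rounds up to `t`). -/
structure Params (A : ℕ) where
  Ψ : (Fin A → ℝ) → ℝ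
  C₁ : ℝ
  C₂ : ℝ
  δ : ℝ
  T : ℕ
  xc : Fin A → ℝ
  delay : ℕ → ℕ

/-- What is stored about a past round of the current phase. -/
structure Record (A : ℕ) where
  /-- the round `u` -/
  round : ℕ
  /-- the arm `A_u` -/
  arm : Fin A
  /-- the loss `ℓ_u(A_u)`; the algorithm reads it only once it has arrived -/
  loss : ℝ
  /-- the strategy `x̂_u` of the base learner -/
  base : Fin A → ℝ
  /-- the mixed strategy `x_u` that was played -/
  played : Fin A → ℝ
  /-- the action scale `σ_u` -/
  scale : ℝ
  /-- the remaining budget `v_u` -/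
  credit : ℝ

/-- The state of the algorithm at the beginning of a round. -/
structure State (A : ℕ) where
  /-- the current round `t` -/
  time : ℕ
  /-- the first round of the current phase -/
  start : ℕ
  /-- the number `k ≥ 1` of the current aggression phase -/
  phase : ℕ
  /-- the current delay estimate `D̂_s` -/
  delayEst : ℕ
  /-- the rounds `start, …, t - 1` of the current phase, in this order -/
  records : List (Record A)

variable {A : ℕ}

/-- The uniform strategy `x_0`. -/
def uniform (A : ℕ) : Fin A → ℝ := fun _ => 1 / (A : ℝ)

namespace Record

/-- The importance-weighted estimator `ℓ̂_u = (ℓ_u(A_u) / x_u(A_u)) e_{A_u}`. -/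
def lossEst (r : Record A) : Fin A → ℝ :=
  Pi.single r.arm (r.loss / r.played r.arm)

/-- The mirror step `z_u = ∇Ψ̄*(∇Ψ(x̂_u) - ℓ̂_u / σ_u)`. -/
def mirror (P : Params A) (r : Record A) : Fin A → ℝ :=
  grad (simplexConj P.Ψ) (grad P.Ψ r.base - (1 / r.scale) • r.lossEst)

/-- The feedback of the round has arrived before round `t`; it arrives at the end of round
`u + d_u`. -/
def ArrivedBefore (P : Params A) (r : Record A) (t : ℕ) : Prop :=
  r.round + P.delay r.round < t

instance (P : Params A) (r : Record A) (t : ℕ) : Decidable (r.ArrivedBefore P t) :=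
  inferInstanceAs (Decidable (_ < _))

end Record

namespace Params

/-- `R̂(D̂) = √(C₁C₂) (3√T + 7√(2 D̂ ln(D̂ + 1)))`. -/
def regretBudget (P : Params A) (D : ℕ) : ℝ :=
  √(P.C₁ * P.C₂) * (3 * √(P.T : ℝ) + 7 * √(2 * (D : ℝ) * Real.log ((D : ℝ) + 1)))

/-- `ξ̂(D̂) = (√(8 D̂ + 1) - 1) / δ`. -/
def slack (P : Params A) (D : ℕ) : ℝ :=
  (√(8 * (D : ℝ) + 1) - 1) / P.δ

/-- The aggression `α = min {2^(k-1) / R̂(D̂), 1}` in phase `k`. -/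
def aggression (P : Params A) (k D : ℕ) : ℝ :=
  min ((2 : ℝ) ^ (k - 1) / P.regretBudget D) 1

/-- The mixture `α x̂ + (1 - α) x^c`. -/
def mix (P : Params A) (α : ℝ) (x : Fin A → ℝ) : Fin A → ℝ :=
  α • x + (1 - α) • P.xc

/-- The number `𝔡_t` of rounds `τ` with `start ≤ τ < t` whose feedback is outstanding at `t`. -/
def outstanding (P : Params A) (start t : ℕ) : ℕ :=
  ((Finset.Ico start t).filter fun τ => t ≤ τ + P.delay τ).card

/-- The cumulative number `𝔇_t = ∑_{start ≤ u ≤ t} 𝔡_u` of outstanding observations. -/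
def cumOutstanding (P : Params A) (start t : ℕ) : ℕ :=
  ∑ u ∈ Finset.Icc start t, P.outstanding start u

/-- The action scale
`σ_t = √(C₂/C₁) (1/√(t - start + 1) + 𝔡_t √(ln(𝔇_t + 1)/𝔇_t))⁻¹`, where the second summand
is `0` if `𝔡_t = 𝔇_t = 0`. -/
def scale (P : Params A) (start t : ℕ) : ℝ :=
  √(P.C₂ / P.C₁) *
    (1 / √((t - start + 1 : ℕ) : ℝ) +
      (P.outstanding start t : ℝ) *
        √(Real.log ((P.cumOutstanding start t : ℝ) + 1) / (P.cumOutstanding start t : ℝ)))⁻¹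

/-- Withdraw the bill `b` from the arrived rounds, in chronological order: round `u` contributes
`σ_{t,u} = min {v_u, b}`, and `v_u` and `b` decrease by this amount. The result consists of the
records with their updated budgets, paired with the amounts `σ_{t,u}`, and of the rest `b_t` of
the bill. -/
def withdraw (P : Params A) (t : ℕ) : List (Record A) → ℝ → List (Record A × ℝ) × ℝ
  | [], b => ([], b)
  | r :: rs, b =>
    if r.ArrivedBefore P t then
      let w := min r.credit b
      let q := P.withdraw t rs (b - w)
      (({ r with credit := r.credit - w }, w) :: q.1, q.2)
    else
      let q := P.withdraw t rs b
      ((r, 0) :: q.1, q.2)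

/-- The withdrawals of the current round. -/
def bank (P : Params A) (s : State A) : List (Record A × ℝ) × ℝ :=
  P.withdraw s.time s.records (P.scale s.start s.time)

/-- The strategy of the base learner,
`x̂_t = ∇Ψ̄*(σ_t⁻¹ ∑_u σ_{t,u} ∇Ψ(z_u) + (b_t / σ_t) ∇Ψ(x_0))`. -/
def baseStrategy (P : Params A) (s : State A) : Fin A → ℝ :=
  grad (simplexConj P.Ψ)
    ((1 / P.scale s.start s.time) •
        ((P.bank s).1.map fun q => q.2 • grad P.Ψ (q.1.mirror P)).sum +
      ((P.bank s).2 / P.scale s.start s.time) • grad P.Ψ (uniform A))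

/-- The total delay `∑_{start ≤ r ≤ t} d_r` that is compared with the estimate `D̂_s`. -/
def stageDelay (P : Params A) (s : State A) : ℕ :=
  ∑ r ∈ Finset.Icc s.start s.time, P.delay r

/-- The new delay estimate `2^⌈log₂ D_t⌉` after a hard restart. -/
def newDelayEst (P : Params A) (s : State A) : ℕ := 2 ^ Nat.clog 2 (P.stageDelay s)

/-- The mixed strategy `x_t`. In a round with a hard restart the base strategy is `x_0`. -/
def play (P : Params A) (s : State A) : Fin A → ℝ :=
  if s.delayEst < P.stageDelay s then
    P.mix (P.aggression 1 (P.newDelayEst s)) (uniform A)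
  else
    P.mix (P.aggression s.phase s.delayEst) (P.baseStrategy s)

/-- The records of the current phase at the end of a round in which `arm` was drawn. -/
def newRecords (P : Params A) (s : State A) (arm : Fin A) (loss : ℝ) : List (Record A) :=
  (P.bank s).1.map Prod.fst ++
    [{ round := s.time, arm := arm, loss := loss, base := P.baseStrategy s, played := P.play s,
       scale := P.scale s.start s.time, credit := P.scale s.start s.time }]

/-- The sum `g_t` of the loss estimates of the phase that have arrived by the end of round `t`. -/
def arrivedLoss (P : Params A) (t : ℕ) (rs : List (Record A)) : Fin A → ℝ :=
  ((rs.filter fun r => r.ArrivedBefore P (t + 1)).map Record.lossEst).sum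

/-- `max_{x ∈ Δ_A} ⟨g, x^c - x⟩`. -/
def gap (P : Params A) (g : Fin A → ℝ) : ℝ :=
  ⨆ x : stdSimplex ℝ (Fin A), g ⬝ᵥ (P.xc - (x : Fin A → ℝ))

/-- One round: the delay check with the hard restart, the update of the base learner, and the
safety check with the soft restart. -/
def step (P : Params A) (s : State A) (arm : Fin A) (loss : ℝ) : State A :=
  if s.delayEst < P.stageDelay s then
    { time := s.time + 1, start := s.time + 1, phase := 1, delayEst := P.newDelayEst s,
      records := [] }
  else if 2 * P.regretBudget s.delayEst + P.slack s.delayEst <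
        P.gap (P.arrivedLoss s.time (P.newRecords s arm loss)) ∧
      P.aggression s.phase s.delayEst < 1 then
    { time := s.time + 1, start := s.time + 1, phase := s.phase + 1, delayEst := s.delayEst,
      records := [] }
  else
    { s with time := s.time + 1, records := P.newRecords s arm loss }

/-- The initial state. -/
def init (A : ℕ) : State A :=
  { time := 0, start := 0, phase := 1, delayEst := 1, records := [] }

/-- Prudent-Banker as a learner. -/
def prudentBanker (P : Params A) : Learner A := fun h =>
  P.play (h.foldl (fun s q => P.step s q.1 q.2) (Params.init A))

end Params

/-- Prudent-Banker with the negative-entropy regularizer, for which `C₁ = log A` and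
`C₂ = 1 / δ`. -/
def entropyPrudentBanker {A : ℕ} (T : ℕ) (δ : ℝ) (xc : Fin A → ℝ) (delay : ℕ → ℕ) : Learner A :=
  Params.prudentBanker
    { Ψ := negEntropy, C₁ := Real.log A, C₂ := 1 / δ, δ := δ, T := T, xc := xc, delay := delay }

end

end SafeBandit

/-! Upper bound. Without delays the banking scheme telescopes: scales grow within a phase, so each
round withdraws exactly the credit of the preceding one, and the base learner is exponential weights
on all loss estimates of the phase (`Settled.baseStrategy_eq`). Mixing with a baseline of margin `δ`
keeps the variance of the estimates at most `1 / δ`, so `energy`, the free energy plus the unspent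
variance budget, pays for the expected base loss (`Entropic.sum_play_mul_energy_le`). Both
guarantees follow from potentials that dominate the round regret plus their own expected next value
(`regretAgainst_le_potential`). Against the baseline, a round only costs `α` times the base regret.
A restart with evidence above `2 R̂` leaves potential at least `2 α R̂ = 2 ^ k`, which is what the
next phase, with doubled `α`, needs at its start; hence the initial bound `1` survives all phases.
Against an arbitrary strategy, the baseline part of the mixture is controlled because a phase with
`α < 1` stops once the estimated gap passes the threshold. The overshoot costs at most `1`, and
there are only logarithmically many phases. Lower bound. The baseline puts only `δ` on an arm whose
loss is a coin, all other arms having loss `1 / 2`. If the coin is slightly bad, safety limits the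
draws of that arm to about `T δ + Λ / Δ`. So few draws cannot distinguish it from a slightly good
coin when `Δ` is of order `1 / √(δ T)` (`exp_pulls_le`), and missing the good arm costs a constant
fraction of `Δ T`, of order `√(T / δ)`. -/

namespace SafeBandit

/-! ## Dynamic programming for the expected regret -/

/-- The learner that results from `L` if the pair `q` was observed in an additional first round. -/
def Learner.shift {A : ℕ} (L : Learner A) (q : Fin A × ℝ) : Learner A := fun h => L (q :: h)

theorem Learner.IsValid.shift {A : ℕ} {L : Learner A} (hL : L.IsValid) (q : Fin A × ℝ) :
    (L.shift q).IsValid := fun h => hL (q :: h)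

theorem history_zero {A T : ℕ} (loss : Fin T → Fin A → ℝ) (a : Fin T → Fin A) :
    history loss a 0 = [] := by
  simp [history]

theorem history_cons_succ {A T : ℕ} (loss : Fin (T + 1) → Fin A → ℝ) (i : Fin A)
    (a : Fin T → Fin A) (t : ℕ) :
    history loss (Fin.cons i a : Fin (T + 1) → Fin A) (t + 1) =
      (i, loss 0 i) :: history (fun s => loss s.succ) a t := by
  simp [history, List.ofFn_succ]

theorem pathProb_cons {A T : ℕ} (L : Learner A) (loss : Fin (T + 1) → Fin A → ℝ) (i : Fin A)
    (a : Fin T → Fin A) :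
    pathProb L loss (Fin.cons i a : Fin (T + 1) → Fin A) =
      L [] i * pathProb (L.shift (i, loss 0 i)) (fun s => loss s.succ) a := by
  simp [pathProb, Fin.prod_univ_succ, history_zero, history_cons_succ, Learner.shift]

theorem sum_cons {A T : ℕ} (f : (Fin (T + 1) → Fin A) → ℝ) :
    ∑ a, f a = ∑ i : Fin A, ∑ a : Fin T → Fin A, f (Fin.cons i a : Fin (T + 1) → Fin A) := by
  rw [← (Fin.consEquiv fun _ : Fin (T + 1) => Fin A).sum_comp, Fintype.sum_prod_type]
  rfl

theorem sum_pathProb {A T : ℕ} {L : Learner A} (hL : L.IsValid) (loss : Fin T → Fin A → ℝ) :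
    ∑ a, pathProb L loss a = 1 := by
  induction T generalizing L with
  | zero => simp [pathProb]
  | succ T ih =>
    simp only [sum_cons, pathProb_cons, ← Finset.mul_sum, ih (hL.shift _), mul_one]
    exact (hL []).2

theorem regretAgainst_zero {A : ℕ} (L : Learner A) (loss : Fin 0 → Fin A → ℝ) (x : Fin A → ℝ) :
    regretAgainst L loss x = 0 := by
  simp [regretAgainst]

/-- Conditioning on the first draw. Validity makes the tail path probabilities sum to `1`, which
frees the first-round term from the later arms. -/
theorem regretAgainst_succ {A T : ℕ} {L : Learner A} (hL : L.IsValid)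
    (loss : Fin (T + 1) → Fin A → ℝ) (x : Fin A → ℝ) :
    regretAgainst L loss x = loss 0 ⬝ᵥ (L [] - x) +
      ∑ i, L [] i * regretAgainst (L.shift (i, loss 0 i)) (fun s => loss s.succ) x := by
  have h1 : ∀ i (a : Fin T → Fin A),
      pathProb L loss (Fin.cons i a : Fin (T + 1) → Fin A) *
        ∑ t : Fin (T + 1), loss t ⬝ᵥ
          (L (history loss (Fin.cons i a : Fin (T + 1) → Fin A) t) - x) =
      L [] i * (pathProb (L.shift (i, loss 0 i)) (fun s => loss s.succ) a *
          (loss 0 ⬝ᵥ (L [] - x))) +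
        L [] i * (pathProb (L.shift (i, loss 0 i)) (fun s => loss s.succ) a *
          ∑ t : Fin T, loss t.succ ⬝ᵥ
            (L.shift (i, loss 0 i) (history (fun s => loss s.succ) a t) - x)) := by
    intro i a
    rw [pathProb_cons, Fin.sum_univ_succ]
    simp only [Fin.val_zero, history_zero, Fin.val_succ, history_cons_succ, Learner.shift]
    ring
  unfold regretAgainst
  rw [sum_cons]
  simp only [h1, Finset.sum_add_distrib, ← Finset.mul_sum, ← Finset.sum_mul,
    sum_pathProb (hL.shift _), one_mul]
  rw [(hL []).2, one_mul]

theorem continuous_regretAgainst {A T : ℕ} (L : Learner A) (loss : Fin T → Fin A → ℝ) :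
    Continuous (regretAgainst L loss) := by
  unfold regretAgainst dotProduct
  fun_prop

/-- Compactness of the simplex bounds the range; an unbounded real supremum would take the default
value `0`. -/
theorem regretAgainst_le_regret {A T : ℕ} (L : Learner A) (loss : Fin T → Fin A → ℝ)
    {x : Fin A → ℝ} (hx : x ∈ stdSimplex ℝ (Fin A)) :
    regretAgainst L loss x ≤ regret L loss := by
  have hb : BddAbove (Set.range fun x : stdSimplex ℝ (Fin A) => regretAgainst L loss x) := by
    have := ((isCompact_stdSimplex ℝ (Fin A)).image (continuous_regretAgainst L loss)).bddAbove
    rwa [Set.image_eq_range] at this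
  exact le_ciSup hb ⟨x, hx⟩

namespace Params

/-- The learner that runs the algorithm from the state `s`. -/
noncomputable def learnerFrom {A : ℕ} (P : Params A) (s : State A) : Learner A := fun h =>
  P.play (h.foldl (fun s q => P.step s q.1 q.2) s)

theorem learnerFrom_nil {A : ℕ} (P : Params A) (s : State A) :
    P.learnerFrom s [] = P.play s := rfl

theorem learnerFrom_shift {A : ℕ} (P : Params A) (s : State A) (q : Fin A × ℝ) :
    (P.learnerFrom s).shift q = P.learnerFrom (P.step s q.1 q.2) := rfl

theorem step_time {A : ℕ} (P : Params A) (s : State A) (i : Fin A) (l : ℝ) :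
    (P.step s i l).time = s.time + 1 := by
  unfold step
  split_ifs <;> rfl

/-- A potential on the states that dominates the regret of a round plus its own expected value
after the round dominates the expected regret. -/
theorem regretAgainst_le_potential {A : ℕ} (P : Params A)
    (hP : ∀ s, P.play s ∈ stdSimplex ℝ (Fin A)) (x : Fin A → ℝ) (T : ℕ) (Inv : State A → Prop) (Φ : State A → ℝ)
    (hend : ∀ s, Inv s → s.time = T → 0 ≤ Φ s)
    (hinv : ∀ s, Inv s → s.time < T → ∀ i, ∀ l ∈ Set.Icc (0 : ℝ) 1, Inv (P.step s i l))
    (hstep : ∀ s, Inv s → s.time < T → ∀ l : Fin A → ℝ, (∀ i, l i ∈ Set.Icc (0 : ℝ) 1) →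
      l ⬝ᵥ (P.play s - x) + ∑ i, P.play s i * Φ (P.step s i (l i)) ≤ Φ s)
    (n : ℕ) (s : State A) (hs : Inv s) (hn : s.time + n = T) (loss : Fin n → Fin A → ℝ)
    (hl : IsLossSeq loss) : regretAgainst (P.learnerFrom s) loss x ≤ Φ s := by
  induction n generalizing s with
  | zero =>
    rw [regretAgainst_zero]
    exact hend s hs (by omega)
  | succ n ih =>
    rw [regretAgainst_succ (L := P.learnerFrom s) (fun h => hP _)]
    refine le_trans ?_ (hstep s hs (by omega) (loss 0) (hl 0))
    rw [learnerFrom_nil]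
    gcongr with i
    · exact (hP s).1 i
    · rw [learnerFrom_shift]
      exact ih _ (hinv s hs (by omega) i _ (hl 0 i)) (by rw [step_time]; omega) _
        fun t j => hl t.succ j

end Params
/-! ## The lower bound -/

/-- The loss vector in which arm `i` has loss `0` or `1` and the other arms have loss `1 / 2`. -/
noncomputable def coinLoss {A : ℕ} (i : Fin A) (b : Bool) : Fin A → ℝ :=
  fun a => if a = i then (if b then 1 else 0) else 1 / 2

/-- The expectation of a function of `n` independent coins with success probability `p`. -/
def coinAvg (p : ℝ) : (n : ℕ) → ((Fin n → Bool) → ℝ) → ℝ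
  | 0, F => F Fin.elim0
  | n + 1, F =>
    p * coinAvg p n (fun b => F (Fin.cons true b)) +
      (1 - p) * coinAvg p n (fun b => F (Fin.cons false b))

/-- The expected number of draws of arm `i` in `n` rounds in which the loss of arm `i` is a coin
with success probability `p`. -/
noncomputable def pulls {A : ℕ} (i : Fin A) (p : ℝ) : ℕ → Learner A → ℝ
  | 0, _ => 0
  | n + 1, L =>
    L [] i + ∑ a, L [] a * (p * pulls i p n (L.shift (a, coinLoss i true a)) +
      (1 - p) * pulls i p n (L.shift (a, coinLoss i false a)))

/-! ### Averages over random coins and their derandomization. -/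

theorem coinAvg_const (p c : ℝ) (n : ℕ) : coinAvg p n (fun _ => c) = c := by
  induction n with
  | zero => rfl
  | succ n ih => simp only [coinAvg, ih]; ring

theorem coinAvg_add (p : ℝ) (n : ℕ) (F G : (Fin n → Bool) → ℝ) :
    coinAvg p n (fun b => F b + G b) = coinAvg p n F + coinAvg p n G := by
  induction n with
  | zero => rfl
  | succ n ih => simp only [coinAvg, ih]; ring

theorem coinAvg_const_mul (p c : ℝ) (n : ℕ) (F : (Fin n → Bool) → ℝ) :
    coinAvg p n (fun b => c * F b) = c * coinAvg p n F := by
  induction n with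
  | zero => rfl
  | succ n ih => simp only [coinAvg, ih]; ring

theorem coinAvg_sum {ι : Type*} (s : Finset ι) (p : ℝ) (n : ℕ) (F : ι → (Fin n → Bool) → ℝ) :
    coinAvg p n (fun b => ∑ i ∈ s, F i b) = ∑ i ∈ s, coinAvg p n (F i) := by
  induction n with
  | zero => rfl
  | succ n ih => simp only [coinAvg, ih, Finset.mul_sum, Finset.sum_add_distrib]

/-- Derandomization: some fixed outcome is at least the mean, so a random adversary yields an
oblivious deterministic one. -/
theorem exists_coinAvg_le {p : ℝ} (h0 : 0 ≤ p) (h1 : p ≤ 1) (n : ℕ) (F : (Fin n → Bool) → ℝ) :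
    ∃ b, coinAvg p n F ≤ F b := by
  induction n with
  | zero => exact ⟨_, le_rfl⟩
  | succ n ih =>
    obtain ⟨b, hb⟩ := ih fun b => F (Fin.cons true b)
    obtain ⟨b', hb'⟩ := ih fun b => F (Fin.cons false b)
    simp only [coinAvg]
    rcases le_total (F (Fin.cons true b)) (F (Fin.cons false b')) with h | h
    · exact ⟨Fin.cons false b', by nlinarith⟩
    · exact ⟨Fin.cons true b, by nlinarith⟩

theorem coinLoss_mem {A : ℕ} (i : Fin A) (b : Bool) (a : Fin A) :
    coinLoss i b a ∈ Set.Icc (0 : ℝ) 1 := by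
  unfold coinLoss
  split_ifs <;> constructor <;> norm_num

/-- The constant loss `1 / 2` cancels between two strategies of equal total mass, so only arm `i`
matters. -/
theorem coinLoss_dotProduct {A : ℕ} (i : Fin A) (b : Bool) {x y : Fin A → ℝ}
    (hx : ∑ a, x a = 1) (hy : ∑ a, y a = 1) :
    coinLoss i b ⬝ᵥ (y - x) = ((if b then 1 else 0) - 1 / 2) * (y i - x i) := by
  have h : ∀ a, coinLoss i b a * (y a - x a) =
      (if a = i then ((if b then 1 else 0) - 1 / 2) * (y a - x a) else 0) +
        1 / 2 * (y a - x a) := by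
    intro a
    unfold coinLoss
    split_ifs <;> ring
  simp only [dotProduct, Pi.sub_apply, h, Finset.sum_add_distrib, ← Finset.mul_sum,
    Finset.sum_sub_distrib, hx, hy]
  simp

theorem coinAvg_regretAgainst {A : ℕ} (i : Fin A) (p : ℝ) {x : Fin A → ℝ}
    (hx : ∑ a, x a = 1) (n : ℕ) {L : Learner A} (hL : L.IsValid) :
    coinAvg p n (fun b => regretAgainst L (fun t => coinLoss i (b t)) x) =
      (p - 1 / 2) * (pulls i p n L - n * x i) := by
  induction n generalizing L with
  | zero => simp [coinAvg, regretAgainst_zero, pulls]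
  | succ n ih =>
    have h1 : ∀ c (b : Fin n → Bool),
        regretAgainst L (fun t : Fin (n + 1) => coinLoss i ((Fin.cons c b : Fin (n + 1) → Bool) t))
          x = coinLoss i c ⬝ᵥ (L [] - x) +
            ∑ a, L [] a * regretAgainst (L.shift (a, coinLoss i c a))
              (fun t => coinLoss i (b t)) x := by
      intro c b
      rw [regretAgainst_succ hL]
      simp
    simp only [coinAvg, h1, coinAvg_add, coinAvg_const, coinAvg_sum, coinAvg_const_mul,
      ih (hL.shift _), pulls, coinLoss_dotProduct i _ hx (hL []).2]
    have h2 : ∀ c, ∑ a, L [] a * ((p - 1 / 2) * (pulls i p n (L.shift (a, coinLoss i c a)) -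
        n * x i)) = (p - 1 / 2) * (∑ a, L [] a * pulls i p n (L.shift (a, coinLoss i c a)) -
          n * x i) := by
      intro c
      have : ∀ a, L [] a * ((p - 1 / 2) * (pulls i p n (L.shift (a, coinLoss i c a)) -
          n * x i)) = (p - 1 / 2) * (L [] a * pulls i p n (L.shift (a, coinLoss i c a))) -
            L [] a * ((p - 1 / 2) * (n * x i)) := fun a => by ring
      simp only [this, Finset.sum_sub_distrib, ← Finset.mul_sum, ← Finset.sum_mul, (hL []).2]
      ring
    have h3 : ∑ a, L [] a * (p * pulls i p n (L.shift (a, coinLoss i true a)) +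
        (1 - p) * pulls i p n (L.shift (a, coinLoss i false a))) =
        p * ∑ a, L [] a * pulls i p n (L.shift (a, coinLoss i true a)) +
        (1 - p) * ∑ a, L [] a * pulls i p n (L.shift (a, coinLoss i false a)) := by
      simp only [Finset.mul_sum, ← Finset.sum_add_distrib]
      exact Finset.sum_congr rfl fun a _ => by ring
    rw [h2, h2, h3]
    push_cast
    simp
    ring

/-- The change of measure for one coin. -/
theorem exp_coin_le {Δ : ℝ} (h0 : 0 ≤ Δ) (h1 : Δ ≤ 1 / 4) (y z : ℝ) :
    Real.exp ((1 / 2 + Δ) * y + (1 / 2 - Δ) * z - 16 * Δ ^ 2) ≤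
      (1 / 2 - Δ) * Real.exp y + (1 / 2 + Δ) * Real.exp z := by
  set l := Real.log ((1 / 2 + Δ) / (1 / 2 - Δ)) with hl
  have hm : 0 < 1 / 2 - Δ := by linarith
  have hp : 0 < 1 / 2 + Δ := by linarith
  have hel : Real.exp l = (1 / 2 + Δ) / (1 / 2 - Δ) := Real.exp_log (by positivity)
  have hl8 : l ≤ 8 * Δ := by
    have := Real.log_le_sub_one_of_pos (div_pos hp hm)
    refine this.trans ?_
    rw [div_sub_one hm.ne', div_le_iff₀ hm]
    nlinarith
  -- Jensen after shifting by the log-likelihood ratio `l`, which turns the weights of one coin into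
  -- those of the other. The exponent loses the divergence `2 Δ l ≤ 16 Δ ^ 2`.
  have hconv := convexOn_exp.2 (Set.mem_univ (y - l)) (Set.mem_univ (z + l)) hp.le hm.le (by ring)
  simp only [smul_eq_mul] at hconv
  calc _ ≤ Real.exp ((1 / 2 + Δ) * (y - l) + (1 / 2 - Δ) * (z + l)) := by
        apply Real.exp_le_exp.2
        nlinarith
    _ ≤ _ := hconv
    _ = _ := by
        rw [Real.exp_sub, Real.exp_add, hel]
        generalize 1 / 2 + Δ = u at *
        generalize 1 / 2 - Δ = v at *
        field_simp

/-- Change of measure, done round by round instead of through a chain rule for divergences. With `N`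
the number of draws of arm `i`, the heuristic is `exp (-λ E₀ N - KL) ≤ E₁ exp (-λ N) ≤ 1 - θ E₁ N`,
where `KL ≤ 16 Δ ^ 2 E₀ N`. The variable `r` accumulates the probabilities already put on arm `i`,
so `hθ` is needed only at the end of the induction. -/
theorem exp_pulls_le {A : ℕ} (i : Fin A) {Δ lam θ R : ℝ} (h0 : 0 ≤ Δ) (h1 : Δ ≤ 1 / 4)
    (hθ : ∀ r ∈ Set.Icc 0 R, Real.exp (-(lam * r)) ≤ 1 - θ * r)
    (n : ℕ) {L : Learner A} (hL : L.IsValid) {r : ℝ} (hr : 0 ≤ r) (hrn : r + n ≤ R) :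
    Real.exp (-((lam + 16 * Δ ^ 2) * pulls i (1 / 2 + Δ) n L) - lam * r) ≤
      1 - θ * (r + pulls i (1 / 2 - Δ) n L) := by
  induction n generalizing L r with
  | zero =>
    simpa [pulls] using hθ r ⟨hr, by simpa using hrn⟩
  | succ n ih =>
    set x := L [] i with hx
    have hx0 : 0 ≤ x := (hL []).1 i
    have hx1 : x ≤ 1 := by
      rw [← (hL []).2]
      exact Finset.single_le_sum (fun a _ => (hL []).1 a) (Finset.mem_univ i)
    push_cast at hrn
    have IH := fun q => ih (hL.shift q) (r := r + x) (by positivity) (by linarith)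
    set N₀ := fun a c => pulls i (1 / 2 + Δ) n (L.shift (a, coinLoss i c a)) with hN₀
    set N₁ := fun a c => pulls i (1 / 2 - Δ) n (L.shift (a, coinLoss i c a)) with hN₁
    set k := lam + 16 * Δ ^ 2 with hk
    -- Only a draw of arm `i` reveals the coin, so only that branch pays `16 Δ ^ 2`; averaging over
    -- the arms charges it `x` times.
    have harm : ∀ a, Real.exp (-(k * ((1 / 2 + Δ) * N₀ a true + (1 / 2 - Δ) * N₀ a false))
        - lam * (r + x) - (if a = i then 16 * Δ ^ 2 else 0)) ≤
        1 - θ * (r + x + ((1 / 2 - Δ) * N₁ a true + (1 / 2 + Δ) * N₁ a false)) := by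
      intro a
      have ht := IH (a, coinLoss i true a)
      have hf := IH (a, coinLoss i false a)
      split_ifs with hai
      · have := exp_coin_le h0 h1 (-(k * N₀ a true) - lam * (r + x))
          (-(k * N₀ a false) - lam * (r + x))
        have e : (1 / 2 + Δ) * (-(k * N₀ a true) - lam * (r + x)) +
          (1 / 2 - Δ) * (-(k * N₀ a false) - lam * (r + x)) - 16 * Δ ^ 2 =
          -(k * ((1 / 2 + Δ) * N₀ a true + (1 / 2 - Δ) * N₀ a false))
            - lam * (r + x) - 16 * Δ ^ 2 := by ring
        rw [e] at this
        refine this.trans ?_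
        have t1 := mul_le_mul_of_nonneg_left ht (by linarith : 0 ≤ 1 / 2 - Δ)
        have t2 := mul_le_mul_of_nonneg_left hf (by linarith : 0 ≤ 1 / 2 + Δ)
        simp only [hN₀, hN₁]
        linarith
      · have e : ∀ c, coinLoss i c a = 1 / 2 := fun c => by simp [coinLoss, hai]
        simp only [hN₀, hN₁, e] at ht ⊢
        convert ht using 2 <;> ring
    have hj := convexOn_exp.map_sum_le (t := Finset.univ) (w := L [])
      (p := fun a => -(k * ((1 / 2 + Δ) * N₀ a true + (1 / 2 - Δ) * N₀ a false))
        - lam * (r + x) - (if a = i then 16 * Δ ^ 2 else 0))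
      (fun a _ => (hL []).1 a) (hL []).2 (fun a _ => Set.mem_univ _)
    simp only [smul_eq_mul] at hj
    have hs := Finset.sum_le_sum fun a (_ : a ∈ Finset.univ) =>
      mul_le_mul_of_nonneg_left (harm a) ((hL []).1 a)
    have e1 : ∑ a, L [] a * (-(k * ((1 / 2 + Δ) * N₀ a true + (1 / 2 - Δ) * N₀ a false))
        - lam * (r + x) - (if a = i then 16 * Δ ^ 2 else 0)) =
        -(k * ∑ a, L [] a * ((1 / 2 + Δ) * N₀ a true + (1 / 2 - Δ) * N₀ a false))
        - lam * (r + x) - x * (16 * Δ ^ 2) := by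
      have : ∀ a, L [] a * (-(k * ((1 / 2 + Δ) * N₀ a true + (1 / 2 - Δ) * N₀ a false))
        - lam * (r + x) - (if a = i then 16 * Δ ^ 2 else 0)) =
        -k * (L [] a * ((1 / 2 + Δ) * N₀ a true + (1 / 2 - Δ) * N₀ a false)) -
          L [] a * (lam * (r + x)) - (if a = i then L [] a * (16 * Δ ^ 2) else 0) := by
        intro a
        split_ifs <;> ring
      simp only [this, Finset.sum_sub_distrib, ← Finset.mul_sum, ← Finset.sum_mul, (hL []).2]
      simp [hx]
    have e2 : ∑ a, L [] a *
        (1 - θ * (r + x + ((1 / 2 - Δ) * N₁ a true + (1 / 2 + Δ) * N₁ a false))) =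
        1 - θ * (r + x +
          ∑ a, L [] a * ((1 / 2 - Δ) * N₁ a true + (1 / 2 + Δ) * N₁ a false)) := by
      have : ∀ a, L [] a *
        (1 - θ * (r + x + ((1 / 2 - Δ) * N₁ a true + (1 / 2 + Δ) * N₁ a false))) =
        L [] a * (1 - θ * (r + x)) -
          θ * (L [] a * ((1 / 2 - Δ) * N₁ a true + (1 / 2 + Δ) * N₁ a false)) := fun a => by ring
      simp only [this, Finset.sum_sub_distrib, ← Finset.mul_sum, ← Finset.sum_mul, (hL []).2]
      ring
    rw [e1] at hj
    rw [e2] at hs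
    have hfin := hj.trans hs
    have f1 : 1 - (1 / 2 + Δ) = 1 / 2 - Δ := by ring
    have f2 : 1 - (1 / 2 - Δ) = 1 / 2 + Δ := by ring
    simp only [pulls, f1, f2]
    refine le_trans (le_of_eq ?_) (hfin.trans (le_of_eq ?_))
    · congr 1
      simp only [hk, hx, hN₀]
      ring
    · simp only [hx, hN₁]
      ring

/-- From `(1 - v + v² / 2) (1 + v + v² / 2) = 1 + v⁴ / 4 ≥ 1`. -/
theorem exp_neg_le_quadratic {v : ℝ} (hv : 0 ≤ v) : Real.exp (-v) ≤ 1 - v + v ^ 2 / 2 := by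
  have h := Real.quadratic_le_exp_of_nonneg hv
  have hpos : 0 < 1 - v + v ^ 2 / 2 := by nlinarith [sq_nonneg (v - 1)]
  rw [Real.exp_neg, inv_le_comm₀ (Real.exp_pos v) hpos]
  refine le_trans ?_ h
  rw [inv_le_iff_one_le_mul₀ hpos]
  nlinarith [sq_nonneg (v ^ 2)]

/-- The error term is the geometric mean of `Λ / δ` and the main rate `√(T / δ)`, hence comparable
with either by ordering the two. -/
theorem rpow_three_quarters {Λ δ T : ℝ} (hΛ : 0 ≤ Λ) (hδ : 0 < δ) (hT : 0 < T) :
    √Λ * δ ^ (-(3 / 4) : ℝ) * T ^ ((1 / 4) : ℝ) = √(Λ / δ * √(T / δ)) := by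
  have h1 : δ ^ (-(3 / 4) : ℝ) * T ^ ((1 / 4) : ℝ) = √(1 / δ * √(T / δ)) := by
    have h2 : 1 / δ = δ ^ (-1 : ℝ) := by rw [Real.rpow_neg_one, one_div]
    have h3 : T / δ = T * δ ^ (-1 : ℝ) := by rw [← h2, mul_one_div]
    rw [h3, h2, Real.sqrt_eq_rpow, Real.sqrt_eq_rpow, Real.mul_rpow hT.le (by positivity),
      Real.mul_rpow (by positivity) (by positivity),
      Real.mul_rpow (by positivity) (by positivity), ← Real.rpow_mul hδ.le,
      ← Real.rpow_mul hδ.le, ← Real.rpow_mul hT.le, mul_left_comm, ← Real.rpow_add hδ, mul_comm]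
    norm_num
  rw [mul_assoc, h1, ← Real.sqrt_mul hΛ]
  congr 1
  ring

/-- With `Δ = 1 / (32 s)`, the total information term is `16 Δ ^ 2 T = 1 / (64 δ)`. At `Λ = 0` this
gives `7 / 32 * N₁ ≤ T / 8 + T / 64`, so `N₁` is at most `9 / 14` of the horizon. -/
theorem pulls_arithmetic {T δ Λ s N₀ N₁ : ℝ} (hT : 0 < T) (hδ : 0 < δ)
    (hδ2 : δ ≤ 1 / 2) (hs : 0 < s) (hss : s ^ 2 = δ * T)
    (h₀ : 1 / (32 * s) * (N₀ - T * δ) ≤ Λ)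
    (h₁ : 7 / (32 * T) * N₁ ≤ (1 / (4 * T) + 16 * (1 / (32 * s)) ^ 2) * N₀) :
    1 / (32 * s) * N₁ ≤ 9 / 14 * (T / s / 32) + 8 / 7 * Λ + (Λ / δ) / 14 := by
  have hN₀ : N₀ ≤ T * δ + 32 * s * Λ := by
    rw [one_div, inv_mul_le_iff₀ (by positivity)] at h₀
    linarith
  have hΔ2 : 16 * (1 / (32 * s)) ^ 2 * T = 1 / (64 * δ) := by
    rw [div_pow, mul_pow, hss]
    field_simp
    norm_num
  have hN₁ : 7 / 32 * N₁ ≤ (1 / 4 + 1 / (64 * δ)) * N₀ := by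
    have e1 : T * (7 / (32 * T) * N₁) = 7 / 32 * N₁ := by
      field_simp
    have e2 : T * ((1 / (4 * T) + 16 * (1 / (32 * s)) ^ 2) * N₀) =
        (1 / 4 + 1 / (64 * δ)) * N₀ := by
      rw [← hΔ2]
      generalize 16 * (1 / (32 * s)) ^ 2 = c
      field_simp
    have h := mul_le_mul_of_nonneg_left h₁ hT.le
    rwa [e1, e2] at h
  have hN₁' : 7 / 32 * N₁ ≤ T * δ / 4 + 8 * s * Λ + T / 64 + s * (Λ / δ) / 2 := by
    refine (hN₁.trans (mul_le_mul_of_nonneg_left hN₀ (by positivity))).trans (le_of_eq ?_)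
    field_simp
    ring
  have hTδ : T * δ / 4 ≤ T / 8 := by nlinarith
  have h3 : N₁ ≤ 32 / 7 * (9 / 64 * T + 8 * s * Λ + s * (Λ / δ) / 2) := by linarith
  refine (mul_le_mul_of_nonneg_left h3 (by positivity)).trans (le_of_eq ?_)
  generalize Λ / δ = a
  field_simp
  ring

theorem exists_loss_regret_ge {A T : ℕ} (hA : 2 ≤ A) (hT : 1 ≤ T) {δ : ℝ}
    (h1 : 1 / (64 * (T : ℝ)) ≤ δ) (h2 : δ ≤ 1 / (A : ℝ)) {Λ : ℝ} (hΛ : 0 ≤ Λ) :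
    ∃ xc : Fin A → ℝ, xc ∈ stdSimplex ℝ (Fin A) ∧ (∀ i, δ ≤ xc i) ∧
      ∀ L : Learner A, L.IsValid →
        (∀ loss : Fin T → Fin A → ℝ, IsLossSeq loss → regretAgainst L loss xc ≤ Λ) →
        ∃ loss : Fin T → Fin A → ℝ, IsLossSeq loss ∧
          1 / 100 * √((T : ℝ) / δ)
              - 2 * (√Λ * δ ^ (-(3 / 4) : ℝ) * (T : ℝ) ^ ((1 / 4) : ℝ) + Λ)
            ≤ regret L loss := by
  have hTr : (1 : ℝ) ≤ T := by exact_mod_cast hT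
  have hAr : (2 : ℝ) ≤ A := by exact_mod_cast hA
  have hT0 : (0 : ℝ) < T := by linarith
  have hδ : 0 < δ := lt_of_lt_of_le (by positivity) h1
  have hAδ : A * δ ≤ 1 := by
    rw [le_div_iff₀ (by linarith)] at h2
    linarith
  have hδ2 : δ ≤ 1 / 2 := by nlinarith
  set i : Fin A := ⟨0, by omega⟩ with hi
  set j : Fin A := ⟨1, by omega⟩ with hj
  have hij : i ≠ j := by simp [hi, hj]
  refine ⟨fun a => δ + if a = j then 1 - A * δ else 0, ⟨fun a => ?_, ?_⟩, fun a => ?_, ?_⟩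
  · beta_reduce
    split_ifs <;> linarith
  · simp [Finset.sum_add_distrib]
  · beta_reduce
    split_ifs <;> linarith
  intro L hL hsafe
  rw [rpow_three_quarters hΛ hδ hT0]
  set Y := √((T : ℝ) / δ) with hY
  have hY0 : 0 ≤ Y := Real.sqrt_nonneg _
  -- For such large `Λ` the error term exceeds the main term and zero losses suffice. Otherwise `Λ /
  -- δ` is absorbed into the error term.
  rcases lt_or_ge Y (Λ / δ) with hcase | hcase
  · refine ⟨fun _ _ => 0, fun _ _ => by simp, ?_⟩
    have hr : (0 : ℝ) ≤ regret L (fun (_ : Fin T) (_ : Fin A) => (0 : ℝ)) := by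
      refine le_trans ?_ (regretAgainst_le_regret L _ (hL []))
      simp [regretAgainst, dotProduct]
    have hZ : Y ≤ √(Λ / δ * Y) := Real.le_sqrt_of_sq_le (by nlinarith)
    linarith
  have hZ : Λ / δ ≤ √(Λ / δ * Y) := by
    have : 0 ≤ Λ / δ := by positivity
    exact Real.le_sqrt_of_sq_le (by nlinarith)
  set s := √(δ * T) with hs
  -- The lower bound on `δ` enters here: it makes `Δ ≤ 1 / 4`.
  have hs8 : 1 / 8 ≤ s := by
    apply Real.le_sqrt_of_sq_le
    rw [div_le_iff₀ (by positivity)] at h1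
    linarith
  have hs0 : 0 < s := by linarith
  have hss : s ^ 2 = δ * T := Real.sq_sqrt (by positivity)
  have hYs : Y = T / s := by
    rw [hY, Real.sqrt_eq_iff_mul_self_eq (by positivity) (by positivity), div_mul_div_comm,
      ← pow_two s, hss]
    field_simp
  set Δ := 1 / (32 * s) with hΔ
  have hΔ0 : 0 < Δ := by positivity
  have hΔ4 : Δ ≤ 1 / 4 := by
    rw [hΔ, div_le_div_iff₀ (by positivity) (by norm_num)]
    linarith
  have hlossSeq : ∀ b : Fin T → Bool, IsLossSeq fun t => coinLoss i (b t) :=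
    fun b t a => coinLoss_mem i (b t) a
  obtain ⟨b₀, hb₀⟩ := exists_coinAvg_le (p := 1 / 2 + Δ) (by linarith) (by linarith) T
    fun b => regretAgainst L (fun t => coinLoss i (b t))
      (fun a => δ + if a = j then 1 - A * δ else 0)
  rw [coinAvg_regretAgainst i _ (by simp [Finset.sum_add_distrib]) T hL] at hb₀
  replace hb₀ := hb₀.trans (hsafe _ (hlossSeq b₀))
  simp only [hij, if_false, add_zero, add_sub_cancel_left] at hb₀
  have he : Pi.single i 1 ∈ stdSimplex ℝ (Fin A) := single_mem_stdSimplex ℝ i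
  obtain ⟨b₁, hb₁⟩ := exists_coinAvg_le (p := 1 / 2 - Δ) (by linarith) (by linarith) T
    fun b => regretAgainst L (fun t => coinLoss i (b t)) (Pi.single i 1)
  rw [coinAvg_regretAgainst i _ he.2 T hL] at hb₁
  simp only [Pi.single_eq_same] at hb₁
  refine ⟨_, hlossSeq b₁, ?_⟩
  have hreg := hb₁.trans (regretAgainst_le_regret L _ he)
  -- For `v = r / (4 T) ≤ 1 / 4` the quadratic bound gives `exp (-v) ≤ 1 - 7 / 8 * v`, whence `θ = 7
  -- / 8 * lam`.
  have hkey := exp_pulls_le i (lam := 1 / (4 * T)) (θ := 7 / (32 * T)) (R := T) hΔ0.le hΔ4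
    (by
      intro r hr
      have hv : 0 ≤ 1 / (4 * T) * r := mul_nonneg (by positivity) hr.1
      have hv4 : 1 / (4 * T) * r ≤ 1 / 4 := by
        rw [div_mul_eq_mul_div, div_le_div_iff₀ (by positivity) (by norm_num)]
        linarith [hr.2]
      refine (exp_neg_le_quadratic hv).trans ?_
      have e : 7 / (32 * (T : ℝ)) * r = 7 / 8 * (1 / (4 * T) * r) := by
        field_simp
        ring
      rw [e]
      nlinarith) T hL le_rfl (by simp)
  set N₀ := pulls i (1 / 2 + Δ) T L
  set N₁ := pulls i (1 / 2 - Δ) T L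
  have hlin := (Real.add_one_le_exp _).trans hkey
  have hΔN : Δ * N₁ ≤ 9 / 14 * (T / s / 32) + 8 / 7 * Λ + (Λ / δ) / 14 :=
    pulls_arithmetic hT0 hδ hδ2 hs0 hss hb₀ (by linarith)
  rw [← hYs] at hΔN
  have hZ0 := Real.sqrt_nonneg (Λ / δ * Y)
  have hreg' : Δ * T - Δ * N₁ ≤ regret L fun t => coinLoss i (b₁ t) :=
    le_trans (le_of_eq (by ring)) hreg
  have hΔT : Δ * T = Y / 32 := by
    rw [hYs, hΔ]
    field_simp
  -- The surviving coefficient of `Y` is `(1 - 9 / 14) / 32 = 5 / 448 > 1 / 100`.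
  linarith

/-! ## The entropic mirror map -/

/-- The Gibbs distribution with weights `exp (y i)`. -/
noncomputable def softmax {A : ℕ} (y : Fin A → ℝ) : Fin A → ℝ :=
  fun i => Real.exp (y i) / ∑ j, Real.exp (y j)

theorem sum_exp_pos {A : ℕ} [NeZero A] (y : Fin A → ℝ) : 0 < ∑ j, Real.exp (y j) :=
  Finset.sum_pos (fun _ _ => Real.exp_pos _) Finset.univ_nonempty

theorem softmax_pos {A : ℕ} [NeZero A] (y : Fin A → ℝ) (i : Fin A) : 0 < softmax y i :=
  div_pos (Real.exp_pos _) (sum_exp_pos y)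

theorem softmax_mem {A : ℕ} [NeZero A] (y : Fin A → ℝ) : softmax y ∈ stdSimplex ℝ (Fin A) := by
  refine ⟨fun i => (softmax_pos y i).le, ?_⟩
  simp only [softmax, ← Finset.sum_div]
  exact div_self (sum_exp_pos y).ne'

theorem log_softmax {A : ℕ} [NeZero A] (y : Fin A → ℝ) (i : Fin A) :
    Real.log (softmax y i) = y i - Real.log (∑ j, Real.exp (y j)) := by
  rw [softmax, Real.log_div (Real.exp_ne_zero _) (sum_exp_pos y).ne', Real.log_exp]

theorem softmax_add_const {A : ℕ} [NeZero A] (y : Fin A → ℝ) (c : ℝ) :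
    softmax (fun i => y i + c) = softmax y := by
  funext i
  simp only [softmax, Real.exp_add, ← Finset.sum_mul]
  exact mul_div_mul_right _ _ (Real.exp_ne_zero c)

theorem softmax_zero (A : ℕ) : softmax (0 : Fin A → ℝ) = uniform A := by
  funext i
  simp [softmax, uniform]

/-- The Gibbs variational principle. -/
theorem dotProduct_sub_negEntropy_le {A : ℕ} [NeZero A] (y : Fin A → ℝ) {x : Fin A → ℝ}
    (hx : x ∈ stdSimplex ℝ (Fin A)) :
    y ⬝ᵥ x - negEntropy x ≤ Real.log (∑ j, Real.exp (y j)) := by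
  -- Nonnegativity of the divergence from `softmax y`, termwise through `log u ≤ u - 1`; arms of
  -- zero mass are separate.
  have h : ∀ i, y i * x i - x i * Real.log (x i) ≤
      x i * Real.log (∑ j, Real.exp (y j)) + (softmax y i - x i) := by
    intro i
    rcases (hx.1 i).eq_or_lt with h0 | h0
    · rw [← h0]
      simpa using (softmax_pos y i).le
    · have h1 := Real.log_le_sub_one_of_pos (div_pos (softmax_pos y i) h0)
      rw [Real.log_div (softmax_pos y i).ne' h0.ne', log_softmax] at h1
      have h2 := mul_le_mul_of_nonneg_left h1 h0.le
      have h3 : x i * (softmax y i / x i - 1) = softmax y i - x i := by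
        field_simp
      rw [h3] at h2
      linarith
  have h4 := Finset.sum_le_sum fun i (_ : i ∈ Finset.univ) => h i
  rw [Finset.sum_add_distrib, Finset.sum_sub_distrib, Finset.sum_sub_distrib, ← Finset.sum_mul,
    hx.2, (softmax_mem y).2] at h4
  simpa [dotProduct, negEntropy] using h4

theorem simplexConj_negEntropy {A : ℕ} [NeZero A] :
    simplexConj (negEntropy (A := A)) = fun y => Real.log (∑ j, Real.exp (y j)) := by
  funext y
  have hne : Nonempty (stdSimplex ℝ (Fin A)) := ⟨⟨_, softmax_mem y⟩⟩
  have hle : ∀ x : stdSimplex ℝ (Fin A), y ⬝ᵥ (x : Fin A → ℝ) - negEntropy (x : Fin A → ℝ) ≤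
    Real.log (∑ j, Real.exp (y j)) := fun x => dotProduct_sub_negEntropy_le y x.2
  apply le_antisymm (ciSup_le hle)
  refine le_trans (le_of_eq ?_) (le_ciSup ⟨_, Set.forall_mem_range.2 hle⟩ ⟨_, softmax_mem y⟩)
  have h : ∀ i, y i * softmax y i - softmax y i * Real.log (softmax y i) =
      softmax y i * Real.log (∑ j, Real.exp (y j)) := by
    intro i
    rw [log_softmax]
    ring
  change _ = y ⬝ᵥ softmax y - negEntropy (softmax y)
  simp only [dotProduct, negEntropy, ← Finset.sum_sub_distrib, h, ← Finset.sum_mul,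
    (softmax_mem y).2, one_mul]

theorem grad_simplexConj_negEntropy {A : ℕ} [NeZero A] (y : Fin A → ℝ) :
    grad (simplexConj negEntropy) y = softmax y := by
  funext i
  have h : HasFDerivAt (fun y : Fin A → ℝ => Real.log (∑ j, Real.exp (y j)))
      ((∑ j, Real.exp (y j))⁻¹ • ∑ j, Real.exp (y j) •
        (ContinuousLinearMap.proj j : (Fin A → ℝ) →L[ℝ] ℝ)) y :=
    (HasFDerivAt.fun_sum fun j _ => (hasFDerivAt_apply j y).exp).log (sum_exp_pos y).ne'
  rw [grad, simplexConj_negEntropy, h.fderiv]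
  simp [Pi.single_apply, softmax, div_eq_inv_mul]

theorem grad_negEntropy {A : ℕ} {x : Fin A → ℝ} (hx : ∀ i, 0 < x i) :
    grad negEntropy x = fun i => Real.log (x i) + 1 := by
  funext i
  have h : HasFDerivAt (negEntropy (A := A))
      (∑ j, (Real.log (x j) + 1) • (ContinuousLinearMap.proj j : (Fin A → ℝ) →L[ℝ] ℝ)) x := by
    unfold negEntropy
    refine HasFDerivAt.fun_sum fun j _ => ?_
    have h2 : HasFDerivAt (fun f : Fin A → ℝ => f j)
        (ContinuousLinearMap.proj j : (Fin A → ℝ) →L[ℝ] ℝ) x :=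
      hasFDerivAt_apply (𝕜 := ℝ) j x
    exact (Real.hasDerivAt_mul_log (hx j).ne').comp_hasFDerivAt x h2
  rw [grad, h.fderiv]
  simp [Pi.single_apply]

/-- The entropy gradient inverts the mirror map up to a constant vector, and softmax ignores
constants. Mirror steps and averages of dual points can thus be computed on exponents. -/
theorem exists_grad_negEntropy_softmax {A : ℕ} [NeZero A] (y : Fin A → ℝ) :
    ∃ c, grad negEntropy (softmax y) = fun i => y i + c := by
  refine ⟨1 - Real.log (∑ j, Real.exp (y j)), ?_⟩
  rw [grad_negEntropy (softmax_pos y)]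
  funext i
  rw [log_softmax]
  ring

/-! ## The potential of exponential weights -/

/-- The scaled logarithm of the average exponential weight. -/
noncomputable def freeEnergy {A : ℕ} (σ : ℝ) (L : Fin A → ℝ) : ℝ :=
  σ * Real.log ((∑ i, Real.exp (-(L i / σ))) / A)

theorem freeEnergy_zero {A : ℕ} [NeZero A] (σ : ℝ) : freeEnergy σ (0 : Fin A → ℝ) = 0 := by
  simp [freeEnergy]

/-- The Gibbs principle with the entropy term dropped by its sign; `σ log A` is the price of
normalizing by `A`. -/
theorem neg_dotProduct_le_freeEnergy {A : ℕ} [NeZero A] {σ : ℝ} (hσ : 0 < σ) (L : Fin A → ℝ)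
    {x : Fin A → ℝ} (hx : x ∈ stdSimplex ℝ (Fin A)) :
    -(L ⬝ᵥ x) - σ * Real.log A ≤ freeEnergy σ L := by
  have hA : (A : ℝ) ≠ 0 := NeZero.ne _
  have hent : negEntropy x ≤ 0 := Finset.sum_nonpos fun i _ =>
    Real.mul_log_nonpos (hx.1 i) (by
      rw [← hx.2]
      exact Finset.single_le_sum (fun j _ => hx.1 j) (Finset.mem_univ i))
  have h := dotProduct_sub_negEntropy_le (fun i => -(L i / σ)) hx
  have e : (fun i => -(L i / σ)) ⬝ᵥ x = -(L ⬝ᵥ x) / σ := by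
    simp only [dotProduct, neg_div, Finset.sum_div, ← Finset.sum_neg_distrib]
    exact Finset.sum_congr rfl fun i _ => by ring
  rw [e] at h
  have h2 : -(L ⬝ᵥ x) / σ ≤ Real.log (∑ i, Real.exp (-(L i / σ))) := by linarith
  rw [freeEnergy, Real.log_div (sum_exp_pos _).ne' hA, mul_sub]
  rw [div_le_iff₀ hσ] at h2
  linarith

/-- The power mean inequality with exponent `τ / σ`. The normalization by `A` makes it applicable,
so that increasing the scale between rounds costs nothing. -/
theorem freeEnergy_le_of_le {A : ℕ} [NeZero A] {σ τ : ℝ} (hσ : 0 < σ) (hστ : σ ≤ τ)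
    (L : Fin A → ℝ) : freeEnergy τ L ≤ freeEnergy σ L := by
  have hτ : 0 < τ := hσ.trans_le hστ
  have hA : (0 : ℝ) < A := Nat.cast_pos.2 (NeZero.pos A)
  have h := Real.arith_mean_le_rpow_mean Finset.univ (fun _ : Fin A => 1 / (A : ℝ))
    (fun i => Real.exp (-(L i / τ))) (fun _ _ => by positivity)
    (by simp [hA.ne']) (fun _ _ => (Real.exp_pos _).le) (p := τ / σ) ((one_le_div hσ).2 hστ)
  have e : ∀ i, Real.exp (-(L i / τ)) ^ (τ / σ) = Real.exp (-(L i / σ)) := by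
    intro i
    rw [← Real.exp_mul]
    congr 1
    field_simp
  simp only [e, one_div_div, one_div_mul_eq_div, ← Finset.sum_div] at h
  have hp : ∀ ρ, 0 < (∑ i, Real.exp (-(L i / ρ))) / A := fun ρ => div_pos (sum_exp_pos _) hA
  have h2 := Real.log_le_log (hp τ) h
  rw [Real.log_rpow (hp σ)] at h2
  have h3 := mul_le_mul_of_nonneg_left h2 hτ.le
  rw [← mul_assoc, mul_div_cancel₀ _ hτ.ne'] at h3
  exact h3

/-- The one-step estimate of exponential weights. Since `v` is nonnegative, the quadratic bound on
`exp (-v / σ)` holds however large the importance weights are. -/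
theorem freeEnergy_add_le {A : ℕ} [NeZero A] {σ : ℝ} (hσ : 0 < σ) (L : Fin A → ℝ)
    {v : Fin A → ℝ} (hv : ∀ i, 0 ≤ v i) :
    freeEnergy σ (L + v) ≤ freeEnergy σ L - softmax (fun i => -(L i / σ)) ⬝ᵥ v +
      1 / (2 * σ) * ∑ i, softmax (fun i => -(L i / σ)) i * v i ^ 2 := by
  set s := softmax (fun i => -(L i / σ)) with hs
  have hA : (0 : ℝ) < A := Nat.cast_pos.2 (NeZero.pos A)
  set Z := ∑ i, Real.exp (-(L i / σ)) with hZ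
  have hZ0 : 0 < Z := sum_exp_pos _
  have hsplit : ∑ i, Real.exp (-((L + v) i / σ)) = Z * ∑ i, s i * Real.exp (-(v i / σ)) := by
    rw [Finset.mul_sum]
    refine Finset.sum_congr rfl fun i _ => ?_
    simp only [hs, softmax, ← hZ, Pi.add_apply, add_div, neg_add, Real.exp_add]
    field_simp
  have hq0 : 0 < ∑ i, s i * Real.exp (-(v i / σ)) :=
    Finset.sum_pos (fun i _ => mul_pos (softmax_pos _ i) (Real.exp_pos _)) Finset.univ_nonempty
  have hq : ∑ i, s i * Real.exp (-(v i / σ)) ≤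
      1 - (s ⬝ᵥ v) / σ + (∑ i, s i * v i ^ 2) / (2 * σ ^ 2) := by
    calc _ ≤ ∑ i, (s i - s i * v i / σ + s i * v i ^ 2 / (2 * σ ^ 2)) := by
          refine Finset.sum_le_sum fun i _ => ?_
          refine (mul_le_mul_of_nonneg_left (exp_neg_le_quadratic (div_nonneg (hv i) hσ.le))
            (softmax_pos _ i).le).trans (le_of_eq ?_)
          simp only [← hs]
          field_simp
      _ = _ := by
          rw [Finset.sum_add_distrib, Finset.sum_sub_distrib, (softmax_mem _).2,
            ← Finset.sum_div, ← Finset.sum_div]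
          rfl
  have hlog := (Real.log_le_sub_one_of_pos hq0).trans (sub_le_sub_right hq 1)
  have h2 := mul_le_mul_of_nonneg_left hlog hσ.le
  have e : σ * (1 - s ⬝ᵥ v / σ + (∑ i, s i * v i ^ 2) / (2 * σ ^ 2) - 1) =
      -(s ⬝ᵥ v) + 1 / (2 * σ) * ∑ i, s i * v i ^ 2 := by
    field_simp
    ring
  rw [e] at h2
  unfold freeEnergy
  rw [hsplit, mul_div_right_comm, ← hZ, Real.log_mul (div_pos hZ0 hA).ne' hq0.ne', mul_add]
  linarith

/-- The second moment of the importance-weighted estimator under the mixture with the baseline. -/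
theorem sum_div_mix_le {A : ℕ} {α δ : ℝ} (hα0 : 0 ≤ α) (hα1 : α ≤ 1) (hδ : 0 < δ)
    (hAδ : A * δ ≤ 1) {s c : Fin A → ℝ} (hs : ∀ i, 0 < s i) (hs1 : ∑ i, s i = 1)
    (hc : ∀ i, δ ≤ c i) : ∑ i, s i / (α * s i + (1 - α) * c i) ≤ 1 / δ := by
  have h : ∀ i, s i / (α * s i + (1 - α) * c i) ≤ α + (1 - α) * (s i / δ) := by
    intro i
    have hc0 : 0 < c i := hδ.trans_le (hc i)
    -- Convexity of the reciprocal; summing with `A ≤ 1 / δ` makes the bound uniform in `α`.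
    have h1 : s i / (α * s i + (1 - α) * c i) ≤ α + (1 - α) * (s i / c i) := by
      have hpos : 0 < α * s i + (1 - α) * c i := by
        have := hs i
        rcases hα0.eq_or_lt with h0 | h0
        · rw [← h0]
          simpa using hc0
        · have := mul_pos h0 (hs i)
          have := mul_nonneg (sub_nonneg.2 hα1) hc0.le
          linarith
      rw [div_le_iff₀ hpos]
      have e : (α + (1 - α) * (s i / c i)) * (α * s i + (1 - α) * c i) - s i =
          α * (1 - α) * ((s i - c i) ^ 2 / c i) := by
        field_simp
        ring
      have : 0 ≤ α * (1 - α) * ((s i - c i) ^ 2 / c i) :=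
        mul_nonneg (mul_nonneg hα0 (sub_nonneg.2 hα1)) (by positivity)
      linarith
    refine h1.trans ?_
    have := div_le_div_of_nonneg_left (hs i).le hδ (hc i)
    have := mul_le_mul_of_nonneg_left this (sub_nonneg.2 hα1)
    linarith
  refine (Finset.sum_le_sum fun i _ => h i).trans ?_
  rw [Finset.sum_add_distrib, ← Finset.mul_sum, ← Finset.sum_div, hs1]
  simp only [Finset.sum_const, Finset.card_univ, Fintype.card_fin, nsmul_eq_mul]
  have : (A : ℝ) ≤ 1 / δ := by rwa [le_div_iff₀ hδ]
  nlinarith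

/-! ## The algorithm without delays -/

/-- The sum of the loss estimates of a list of records. -/
noncomputable def cumLoss {A : ℕ} (rs : List (Record A)) : Fin A → ℝ :=
  (rs.map Record.lossEst).sum

theorem cumLoss_append {A : ℕ} (rs rs' : List (Record A)) :
    cumLoss (rs ++ rs') = cumLoss rs + cumLoss rs' := by
  simp [cumLoss]

theorem cumLoss_singleton {A : ℕ} (r : Record A) : cumLoss [r] = r.lossEst := by
  simp [cumLoss]

namespace Params

/-- The entropic algorithm without delays in the rounds before the horizon. -/
structure NoDelay {A : ℕ} (P : Params A) : Prop where
  reg_eq : P.Ψ = negEntropy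
  C₁_pos : 0 < P.C₁
  C₂_pos : 0 < P.C₂
  delay_eq : ∀ t < P.T, P.delay t = 0

variable {A : ℕ} {P : Params A}

theorem mirror_eq_softmax [NeZero A] (hP : P.Ψ = negEntropy) {r : Record A} {L : Fin A → ℝ}
    (hr : r.base = softmax fun i => -(L i / r.scale)) :
    r.mirror P = softmax fun i => -((L + r.lossEst) i / r.scale) := by
  obtain ⟨c, hc⟩ := exists_grad_negEntropy_softmax fun i => -(L i / r.scale)
  rw [Record.mirror, hP, hr, hc, grad_simplexConj_negEntropy,
    ← softmax_add_const (fun i => -((L + r.lossEst) i / r.scale)) c]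
  congr 1
  funext i
  simp only [Pi.sub_apply, Pi.smul_apply, Pi.add_apply, smul_eq_mul]
  ring

/-- Only rounds before `t` count as outstanding, so `t = P.T` is admissible although delays vanish
only before the horizon. -/
theorem NoDelay.scale_eq (hP : P.NoDelay) (start : ℕ) {t : ℕ} (ht : t ≤ P.T) :
    P.scale start t = √(P.C₂ / P.C₁) * √((t - start + 1 : ℕ) : ℝ) := by
  have h : P.outstanding start t = 0 := by
    rw [outstanding, Finset.card_eq_zero, Finset.filter_eq_empty_iff]
    intro τ hτ
    rw [Finset.mem_Ico] at hτ
    rw [hP.delay_eq τ (by omega)]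
    omega
  simp [scale, h]

theorem NoDelay.scale_pos (hP : P.NoDelay) (start : ℕ) {t : ℕ} (ht : t ≤ P.T) :
    0 < P.scale start t := by
  have := hP.C₁_pos
  have := hP.C₂_pos
  rw [hP.scale_eq start ht]
  positivity

theorem NoDelay.scale_mono (hP : P.NoDelay) (start : ℕ) {t u : ℕ} (htu : t ≤ u) (hu : u ≤ P.T) :
    P.scale start t ≤ P.scale start u := by
  rw [hP.scale_eq start hu, hP.scale_eq start (htu.trans hu)]
  gcongr

theorem withdraw_append {t : ℕ} {rs : List (Record A)} {b : ℝ} (hb : 0 ≤ b)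
    (harr : ∀ r ∈ rs, r.ArrivedBefore P t) (hcr : ∀ r ∈ rs, r.credit = 0)
    (rs' : List (Record A)) :
    P.withdraw t (rs ++ rs') b =
      (rs.map (fun r => (r, 0)) ++ (P.withdraw t rs' b).1, (P.withdraw t rs' b).2) := by
  induction rs with
  | nil => rfl
  | cons r rs ih =>
    have h0 : r.credit = 0 := hcr r (by simp)
    have hr : ({ r with credit := 0 } : Record A) = r := by
      cases r
      simpa using h0.symm
    rw [List.cons_append, withdraw, if_pos (harr r (by simp)), h0, min_eq_left hb]
    simp only [sub_zero, hr,
      ih (fun q hq => harr q (by simp [hq])) fun q hq => hcr q (by simp [hq])]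
    rfl

theorem withdraw_singleton {t : ℕ} {r : Record A} {b : ℝ} (hr : r.credit ≤ b)
    (harr : r.ArrivedBefore P t) :
    P.withdraw t [r] b = ([({ r with credit := 0 }, r.credit)], b - r.credit) := by
  rw [withdraw, if_pos harr, min_eq_left hr]
  simp only [sub_self]
  rfl

theorem cumLoss_withdraw (t : ℕ) (rs : List (Record A)) (b : ℝ) :
    cumLoss ((P.withdraw t rs b).1.map Prod.fst) = cumLoss rs := by
  induction rs generalizing b with
  | nil => rfl
  | cons r rs ih =>
    unfold withdraw
    unfold cumLoss at ih ⊢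
    split_ifs
    · simp only [List.map_cons, List.sum_cons, ih]
      rfl
    · simp only [List.map_cons, List.sum_cons, ih]

theorem round_lt_of_mem_withdraw {t u : ℕ} {rs : List (Record A)} {b : ℝ}
    (h : ∀ r ∈ rs, r.round < u) : ∀ q ∈ (P.withdraw t rs b).1.map Prod.fst, q.round < u := by
  induction rs generalizing b with
  | nil => simp [withdraw]
  | cons r rs ih =>
    have hr := h r (by simp)
    have ih' := fun b => ih (b := b) fun q hq => h q (by simp [hq])
    unfold withdraw
    split_ifs
    · simp only [List.map_cons, List.mem_cons, forall_eq_or_imp]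
      exact ⟨hr, ih' _⟩
    · simp only [List.map_cons, List.mem_cons, forall_eq_or_imp]
      exact ⟨hr, ih' _⟩

/-- The threshold of the safety check. -/
noncomputable def threshold (P : Params A) : ℝ := 2 * P.regretBudget 1 + P.slack 1

/-- The invariant of the states that are reached without delays: only the last record of the phase
has credit, and its base strategy is given by exponential weights. -/
structure Settled (P : Params A) (s : State A) : Prop where
  delayEst_eq : s.delayEst = 1
  start_le : s.start ≤ s.time
  phase_pos : 1 ≤ s.phase
  round_lt : ∀ r ∈ s.records, r.round < s.time
  records_eq : (s.records = [] ∧ s.start = s.time) ∨ ∃ rs r, s.records = rs ++ [r] ∧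
    s.start < s.time ∧ (∀ q ∈ rs, q.credit = 0) ∧ r.credit = P.scale s.start (s.time - 1) ∧
    r.scale = P.scale s.start (s.time - 1) ∧ r.base = softmax fun i => -(cumLoss rs i / r.scale)
  gap_le : P.aggression s.phase 1 < 1 → P.gap (cumLoss s.records) ≤ P.threshold

theorem NoDelay.arrivedBefore (hP : P.NoDelay) {r : Record A} {t : ℕ} (hr : r.round < t)
    (ht : t ≤ P.T) : r.ArrivedBefore P t := by
  rw [Record.ArrivedBefore, hP.delay_eq _ (by omega)]
  exact hr

/-- The last record contributes `σ_{t-1}` of the bill and the uniform point the rest. In the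
exponent, `σ_{t-1} / σ_t` times `-L / σ_{t-1}` is `-L / σ_t`: the whole history at the new scale. -/
theorem Settled.baseStrategy_eq [NeZero A] (hP : P.NoDelay) {s : State A} (hs : P.Settled s)
    (ht : s.time < P.T) : P.baseStrategy s =
      softmax fun i => -(cumLoss s.records i / P.scale s.start s.time) := by
  have hσ := hP.scale_pos s.start ht.le
  obtain ⟨c₀, hc₀⟩ := exists_grad_negEntropy_softmax (0 : Fin A → ℝ)
  rw [softmax_zero] at hc₀
  rw [baseStrategy, hP.reg_eq, grad_simplexConj_negEntropy, hc₀]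
  rcases hs.records_eq with ⟨hnil, -⟩ | ⟨rs, r, hrec, hlt, hcr, hcredit, hscale, hbase⟩
  · have hbank : P.bank s = ([], P.scale s.start s.time) := by
      rw [bank, hnil, withdraw]
    rw [hbank, hnil, ← softmax_add_const (fun i => -(cumLoss [] i / _)) c₀]
    congr 1
    funext i
    simp [cumLoss, hσ.ne']
  · have harr : ∀ q ∈ s.records, q.ArrivedBefore P s.time := fun q hq =>
      hP.arrivedBefore (hs.round_lt q hq) ht.le
    have hle : r.credit ≤ P.scale s.start s.time := by
      rw [hcredit]
      exact hP.scale_mono _ (Nat.sub_le _ _) ht.le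
    have hbank : P.bank s = (rs.map (fun r => (r, 0)) ++ [({ r with credit := 0 }, r.credit)],
        P.scale s.start s.time - r.credit) := by
      rw [bank, hrec, withdraw_append hσ.le (fun q hq => harr q (by simp [hrec, hq])) hcr,
        withdraw_singleton hle (harr r (by simp [hrec]))]
    have hmirror : ({ r with credit := 0 } : Record A).mirror P = r.mirror P := rfl
    obtain ⟨c₁, hc₁⟩ := exists_grad_negEntropy_softmax
      fun i => -((cumLoss rs + r.lossEst) i / r.scale)
    -- The added constant collects the normalizations of both dual points with their withdrawal
    -- weights.
    rw [hbank, hrec, ← softmax_add_const (fun i => -(cumLoss (rs ++ [r]) i / _))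
      (r.credit / P.scale s.start s.time * c₁ +
        (P.scale s.start s.time - r.credit) / P.scale s.start s.time * c₀),
      cumLoss_append, cumLoss_singleton]
    congr 1
    have hr0 : r.scale ≠ 0 := by
      rw [hscale]
      exact (hP.scale_pos _ (by omega)).ne'
    have hzero : ∀ l : List (Record A),
        (List.map ((fun q : Record A × ℝ => q.2 • grad negEntropy (q.1.mirror P)) ∘
          fun r => (r, 0)) l).sum = 0 := by
      intro l
      induction l with
      | nil => rfl
      | cons a l ih => simp_all
    simp only [List.map_append, List.map_map, List.sum_append, hzero, List.map_cons, List.map_nil,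
      List.sum_cons, List.sum_nil, hmirror, mirror_eq_softmax hP.reg_eq hbase, hc₁]
    have hcs : r.credit = r.scale := hcredit.trans hscale.symm
    rw [hcs]
    funext i
    simp only [Pi.add_apply, Pi.smul_apply, smul_eq_mul, Pi.zero_apply]
    field_simp
    ring

theorem NoDelay.not_hard_restart (hP : P.NoDelay) {s : State A} (ht : s.time < P.T) :
    ¬ s.delayEst < P.stageDelay s := by
  have h : P.stageDelay s = 0 := Finset.sum_eq_zero fun r hr => by
    rw [Finset.mem_Icc] at hr
    exact hP.delay_eq r (by omega)
  omega

/-- The strategy of the base learner in a settled state. -/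
noncomputable def expWeights (P : Params A) (s : State A) : Fin A → ℝ :=
  softmax fun i => -(cumLoss s.records i / P.scale s.start s.time)

theorem Settled.play_eq [NeZero A] (hP : P.NoDelay) {s : State A} (hs : P.Settled s)
    (ht : s.time < P.T) : P.play s = P.mix (P.aggression s.phase 1) (P.expWeights s) := by
  rw [play, if_neg (hP.not_hard_restart ht), hs.baseStrategy_eq hP ht, hs.delayEst_eq]
  rfl

/-- The cumulative loss estimate of the phase after the round. -/
noncomputable def nextLoss (P : Params A) (s : State A) (i : Fin A) (l : ℝ) : Fin A → ℝ :=
  cumLoss s.records + Pi.single i (l / P.play s i)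

theorem cumLoss_newRecords (s : State A) (i : Fin A) (l : ℝ) :
    cumLoss (P.newRecords s i l) = P.nextLoss s i l := by
  rw [newRecords, cumLoss_append, cumLoss_singleton, bank, cumLoss_withdraw]
  rfl

theorem Settled.round_lt_newRecords {s : State A} (hs : P.Settled s) (i : Fin A) (l : ℝ) :
    ∀ r ∈ P.newRecords s i l, r.round < s.time + 1 := by
  intro r hr
  rw [newRecords, List.mem_append, List.mem_singleton] at hr
  rcases hr with hr | rfl
  · exact Nat.lt_succ_of_lt (round_lt_of_mem_withdraw hs.round_lt r hr)
  · exact Nat.lt_succ_self _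

theorem Settled.arrivedLoss_newRecords (hP : P.NoDelay) {s : State A} (hs : P.Settled s)
    (ht : s.time < P.T) (i : Fin A) (l : ℝ) :
    P.arrivedLoss s.time (P.newRecords s i l) = P.nextLoss s i l := by
  rw [arrivedLoss, List.filter_eq_self.2, ← cumLoss_newRecords]
  · rfl
  · intro r hr
    exact decide_eq_true (hP.arrivedBefore (hs.round_lt_newRecords i l r hr) ht)

theorem Settled.credit_bank (hP : P.NoDelay) {s : State A} (hs : P.Settled s)
    (ht : s.time < P.T) : ∀ q ∈ (P.bank s).1.map Prod.fst, q.credit = 0 := by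
  have hσ := hP.scale_pos s.start ht.le
  rcases hs.records_eq with ⟨hnil, -⟩ | ⟨rs, r, hrec, hlt, hcr, hcredit, hscale, hbase⟩
  · simp [bank, hnil, withdraw]
  · have harr : ∀ q ∈ s.records, q.ArrivedBefore P s.time := fun q hq =>
      hP.arrivedBefore (hs.round_lt q hq) ht.le
    have hle : r.credit ≤ P.scale s.start s.time := by
      rw [hcredit]
      exact hP.scale_mono _ (Nat.sub_le _ _) ht.le
    rw [bank, hrec, withdraw_append hσ.le (fun q hq => harr q (by simp [hrec, hq])) hcr,
        withdraw_singleton hle (harr r (by simp [hrec]))]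
    intro q hq
    simp only [List.map_append, List.map_map, List.mem_append, List.mem_map,
      List.mem_singleton, List.map_cons, List.map_nil, Function.comp] at hq
    rcases hq with ⟨q', hq', rfl⟩ | rfl
    · exact hcr q' hq'
    · rfl

/-- The two possible outcomes of a round of a settled state. -/
theorem Settled.step_cases (hP : P.NoDelay) {s : State A} (hs : P.Settled s)
    (ht : s.time < P.T) (i : Fin A) (l : ℝ) :
    (P.step s i l = ⟨s.time + 1, s.time + 1, s.phase + 1, s.delayEst, []⟩ ∧
      P.aggression s.phase 1 < 1 ∧ P.threshold < P.gap (P.nextLoss s i l)) ∨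
    (P.step s i l =
        ⟨s.time + 1, s.start, s.phase, s.delayEst, P.newRecords s i l⟩ ∧
      (P.aggression s.phase 1 < 1 → P.gap (P.nextLoss s i l) ≤ P.threshold)) := by
  unfold step
  rw [if_neg (hP.not_hard_restart ht), hs.arrivedLoss_newRecords hP ht, hs.delayEst_eq]
  split_ifs with h
  · exact Or.inl ⟨rfl, h.2, h.1⟩
  · refine Or.inr ⟨rfl, fun hα => ?_⟩
    by_contra! hgap
    exact h ⟨hgap, hα⟩

theorem gap_zero [NeZero A] : P.gap (0 : Fin A → ℝ) = 0 := by
  have : Nonempty (stdSimplex ℝ (Fin A)) := ⟨⟨_, softmax_mem 0⟩⟩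
  simp [gap]

theorem Settled.step [NeZero A] (hP : P.NoDelay) (hth : 0 ≤ P.threshold) {s : State A}
    (hs : P.Settled s) (ht : s.time < P.T) (i : Fin A) (l : ℝ) : P.Settled (P.step s i l) := by
  rcases hs.step_cases hP ht i l with ⟨h, -⟩ | ⟨h, hgap⟩
  · rw [h]
    refine ⟨hs.delayEst_eq, le_rfl, Nat.succ_pos _, by simp, Or.inl ⟨rfl, rfl⟩, fun _ => ?_⟩
    change P.gap (cumLoss []) ≤ _
    rw [show cumLoss ([] : List (Record A)) = 0 from rfl, gap_zero]
    exact hth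
  · rw [h]
    refine ⟨hs.delayEst_eq, hs.start_le.trans (Nat.le_succ _), hs.phase_pos,
      hs.round_lt_newRecords i l, Or.inr ⟨_, _, rfl, Nat.lt_succ_of_le hs.start_le,
        hs.credit_bank hP ht, rfl, rfl, ?_⟩, fun hα => ?_⟩
    · change P.baseStrategy s = _
      rw [hs.baseStrategy_eq hP ht, bank, cumLoss_withdraw]
    · change P.gap (cumLoss (P.newRecords s i l)) ≤ _
      rw [cumLoss_newRecords]
      exact hgap hα

theorem settled_init [NeZero A] (hth : 0 ≤ P.threshold) : P.Settled (Params.init A) := by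
  refine ⟨rfl, le_rfl, le_rfl, by simp [Params.init], Or.inl ⟨rfl, rfl⟩, fun _ => ?_⟩
  change P.gap (cumLoss []) ≤ _
  rw [show cumLoss ([] : List (Record A)) = 0 from rfl, gap_zero]
  exact hth

theorem le_gap (g : Fin A → ℝ) {x : Fin A → ℝ} (hx : x ∈ stdSimplex ℝ (Fin A)) :
    g ⬝ᵥ (P.xc - x) ≤ P.gap g := by
  have hc : Continuous fun x : Fin A → ℝ => g ⬝ᵥ (P.xc - x) := by
    unfold dotProduct
    fun_prop
  have hb : BddAbove (Set.range fun x : stdSimplex ℝ (Fin A) =>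
      g ⬝ᵥ (P.xc - (x : Fin A → ℝ))) := by
    have := ((isCompact_stdSimplex ℝ (Fin A)).image hc).bddAbove
    rwa [Set.image_eq_range] at this
  exact le_ciSup hb ⟨x, hx⟩

theorem exists_lt_of_lt_gap [NeZero A] {g : Fin A → ℝ} {b : ℝ} (h : b < P.gap g) :
    ∃ x ∈ stdSimplex ℝ (Fin A), b < g ⬝ᵥ (P.xc - x) := by
  have : Nonempty (stdSimplex ℝ (Fin A)) := ⟨⟨_, softmax_mem 0⟩⟩
  obtain ⟨x, hx⟩ := exists_lt_of_lt_ciSup h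
  exact ⟨x, x.2, hx⟩

/-! ## The potentials of the algorithm -/

/-- The parameters of the entropic algorithm without delays, with a baseline of margin `δ`. -/
structure Entropic {A : ℕ} (P : Params A) : Prop extends P.NoDelay where
  C₁_eq : P.C₁ = Real.log A
  C₂_eq : P.C₂ = 1 / P.δ
  δ_pos : 0 < P.δ
  mul_δ_le : A * P.δ ≤ 1
  xc_mem : P.xc ∈ stdSimplex ℝ (Fin A)
  le_xc : ∀ i, P.δ ≤ P.xc i

theorem NoDelay.regretBudget_pos (hP : P.NoDelay) : 0 < P.regretBudget 1 := by
  have h1 := hP.C₁_pos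
  have h2 := hP.C₂_pos
  have h3 : 0 < Real.log ((1 : ℕ) + 1 : ℝ) := Real.log_pos (by norm_num)
  unfold regretBudget
  positivity

theorem aggression_nonneg (k : ℕ) {D : ℕ} (h : 0 ≤ P.regretBudget D) : 0 ≤ P.aggression k D :=
  le_min (by positivity) zero_le_one

theorem aggression_le_one (k D : ℕ) : P.aggression k D ≤ 1 := min_le_right _ _

theorem aggression_mul_le (k : ℕ) {D : ℕ} (h : 0 < P.regretBudget D) :
    P.aggression k D * P.regretBudget D ≤ 2 ^ (k - 1) :=
  (le_div_iff₀ h).1 (min_le_left _ _)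

theorem aggression_mul_eq {k D : ℕ} (h : 0 < P.regretBudget D) (hk : P.aggression k D < 1) :
    P.aggression k D * P.regretBudget D = 2 ^ (k - 1) := by
  unfold aggression at hk ⊢
  rw [min_eq_left (by
    by_contra! h'
    rw [min_eq_right h'.le] at hk
    exact lt_irrefl _ hk), div_mul_cancel₀ _ h.ne']

theorem slack_nonneg (h : 0 < P.δ) (D : ℕ) : 0 ≤ P.slack D := by
  refine div_nonneg (sub_nonneg.2 (Real.le_sqrt_of_sq_le ?_)) h.le
  nlinarith [(Nat.cast_nonneg D : (0 : ℝ) ≤ D)]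

theorem Entropic.two_mul_le_threshold (hP : P.Entropic) :
    2 * P.regretBudget 1 ≤ P.threshold :=
  le_add_of_nonneg_right (slack_nonneg hP.δ_pos 1)

theorem Entropic.threshold_nonneg (hP : P.Entropic) : 0 ≤ P.threshold :=
  le_trans (by linarith [hP.regretBudget_pos]) hP.two_mul_le_threshold

/-- The free energy of the loss estimates plus the regret budget of the rest of the phase. -/
noncomputable def energy (P : Params A) (start t : ℕ) (L : Fin A → ℝ) : ℝ :=
  freeEnergy (P.scale start t) L +
    √(P.C₁ * P.C₂) * (2 * √((P.T : ℝ) + 1) - √((t - start : ℕ) : ℝ))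

theorem Entropic.scale_mul_log (hP : P.Entropic) (start : ℕ) {t : ℕ} (ht : t ≤ P.T) :
    P.scale start t * Real.log A = √(P.C₁ * P.C₂) * √((t - start + 1 : ℕ) : ℝ) := by
  rw [hP.scale_eq start ht, ← hP.C₁_eq, Real.sqrt_div hP.C₂_pos.le, Real.sqrt_mul hP.C₁_pos.le]
  have := Real.sqrt_pos.2 hP.C₁_pos
  nth_rewrite 2 [← Real.mul_self_sqrt hP.C₁_pos.le]
  field_simp

/-- With `n` rounds played, the entropy price is `√(C₁C₂) √(n + 1)` and the spent variance budget
`√(C₁C₂) √n`; the allowance `2 √(T + 1)` covers both. -/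
theorem Entropic.energy_add_nonneg [NeZero A] (hP : P.Entropic) {start t : ℕ} (ht : t ≤ P.T)
    (L : Fin A → ℝ) {y : Fin A → ℝ} (hy : y ∈ stdSimplex ℝ (Fin A)) :
    0 ≤ P.energy start t L + L ⬝ᵥ y := by
  have h := neg_dotProduct_le_freeEnergy (hP.scale_pos start ht) L hy
  rw [hP.scale_mul_log start ht] at h
  have h1 : √((t - start + 1 : ℕ) : ℝ) ≤ √((P.T : ℝ) + 1) :=
    Real.sqrt_le_sqrt (by exact_mod_cast (by omega : t - start + 1 ≤ P.T + 1))
  have h2 : √((t - start : ℕ) : ℝ) ≤ √((P.T : ℝ) + 1) :=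
    Real.sqrt_le_sqrt (by exact_mod_cast (by omega : t - start ≤ P.T + 1))
  have h3 : 0 ≤ √(P.C₁ * P.C₂) * (2 * √((P.T : ℝ) + 1) - √((t - start : ℕ) : ℝ) -
    √((t - start + 1 : ℕ) : ℝ)) := mul_nonneg (Real.sqrt_nonneg _) (by linarith)
  unfold energy
  linarith

theorem NoDelay.energy_start_le [NeZero A] (t : ℕ) :
    P.energy t t 0 ≤ P.regretBudget 1 := by
  have h1 : 1 ≤ √(2 * ((1 : ℕ) : ℝ) * Real.log (((1 : ℕ) : ℝ) + 1)) := by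
    rw [Nat.cast_one, one_add_one_eq_two]
    refine Real.le_sqrt_of_sq_le ?_
    have := Real.log_two_gt_d9
    norm_num at this ⊢
    linarith
  have h2 : √((P.T : ℝ) + 1) ≤ √(P.T : ℝ) + 1 :=
    Real.sqrt_le_iff.2 ⟨by positivity, by
      nlinarith [Real.sq_sqrt (Nat.cast_nonneg P.T : (0 : ℝ) ≤ P.T), Real.sqrt_nonneg (P.T : ℝ)]⟩
  unfold energy regretBudget
  rw [freeEnergy_zero, zero_add, Nat.sub_self]
  refine mul_le_mul_of_nonneg_left ?_ (Real.sqrt_nonneg _)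
  have := Real.sqrt_nonneg (P.T : ℝ)
  rw [Nat.cast_zero, Real.sqrt_zero]
  linarith

theorem expWeights_pos [NeZero A] (s : State A) (i : Fin A) : 0 < P.expWeights s i :=
  softmax_pos _ i

theorem expWeights_mem [NeZero A] (s : State A) : P.expWeights s ∈ stdSimplex ℝ (Fin A) :=
  softmax_mem _

theorem mix_mem {α : ℝ} (h0 : 0 ≤ α) (h1 : α ≤ 1) (hxc : P.xc ∈ stdSimplex ℝ (Fin A))
    {x : Fin A → ℝ} (hx : x ∈ stdSimplex ℝ (Fin A)) : P.mix α x ∈ stdSimplex ℝ (Fin A) :=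
  convex_stdSimplex ℝ (Fin A) hx hxc h0 (sub_nonneg.2 h1) (by ring)

theorem mix_pos {α : ℝ} (h0 : 0 ≤ α) (h1 : α ≤ 1) {x : Fin A → ℝ} {i : Fin A}
    (hxc : 0 < P.xc i) (hx : 0 < x i) : 0 < P.mix α x i := by
  simp only [mix, Pi.add_apply, Pi.smul_apply, smul_eq_mul]
  rcases h0.eq_or_lt with h | h
  · rw [← h]
    simpa using hxc
  · have := mul_pos h hx
    have := mul_nonneg (sub_nonneg.2 h1) hxc.le
    linarith

theorem Entropic.play_pos [NeZero A] (hP : P.Entropic) {s : State A} (hs : P.Settled s)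
    (ht : s.time < P.T) (i : Fin A) : 0 < P.play s i := by
  rw [hs.play_eq hP.toNoDelay ht]
  exact mix_pos (aggression_nonneg _ hP.regretBudget_pos.le) (aggression_le_one _ _)
    (hP.δ_pos.trans_le (hP.le_xc i)) (expWeights_pos s i)

theorem play_mem [NeZero A] (hΨ : P.Ψ = negEntropy) (hR : ∀ D, 0 ≤ P.regretBudget D)
    (hxc : P.xc ∈ stdSimplex ℝ (Fin A)) (s : State A) : P.play s ∈ stdSimplex ℝ (Fin A) := by
  have hu : uniform A ∈ stdSimplex ℝ (Fin A) := by
    rw [← softmax_zero]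
    exact softmax_mem _
  unfold play
  split_ifs
  · exact mix_mem (aggression_nonneg _ (hR _)) (aggression_le_one _ _) hxc hu
  · refine mix_mem (aggression_nonneg _ (hR _)) (aggression_le_one _ _) hxc ?_
    rw [baseStrategy, hΨ, grad_simplexConj_negEntropy]
    exact softmax_mem _

theorem NoDelay.regretBudget_nonneg (D : ℕ) : 0 ≤ P.regretBudget D := by
  unfold regretBudget
  positivity

theorem Entropic.play_mem [NeZero A] (hP : P.Entropic) (s : State A) :
    P.play s ∈ stdSimplex ℝ (Fin A) :=
  Params.play_mem hP.reg_eq NoDelay.regretBudget_nonneg hP.xc_mem s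

/-- Unbiasedness of the importance-weighted estimator, which needs every arm to be played with
positive probability. -/
theorem Entropic.sum_play_mul_nextLoss [NeZero A] (hP : P.Entropic) {s : State A}
    (hs : P.Settled s) (ht : s.time < P.T) (l y : Fin A → ℝ) :
    ∑ i, P.play s i * (P.nextLoss s i (l i) ⬝ᵥ y) = cumLoss s.records ⬝ᵥ y + l ⬝ᵥ y := by
  have h : ∀ i, P.play s i * (P.nextLoss s i (l i) ⬝ᵥ y) =
      P.play s i * (cumLoss s.records ⬝ᵥ y) + l i * y i := by
    intro i
    have := (hP.play_pos hs ht i).ne'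
    rw [nextLoss, add_dotProduct, single_dotProduct]
    field_simp
  simp only [h, Finset.sum_add_distrib, ← Finset.sum_mul, (hP.play_mem s).2, one_mul]
  rfl

theorem sqrt_add_one_sub_sqrt_ge (n : ℕ) :
    1 / (2 * √((n + 1 : ℕ) : ℝ)) ≤ √((n + 1 : ℕ) : ℝ) - √(n : ℝ) := by
  have h1 : 0 < √((n + 1 : ℕ) : ℝ) := Real.sqrt_pos.2 (by positivity)
  have h2 := Real.sq_sqrt (Nat.cast_nonneg (n + 1) : (0 : ℝ) ≤ (n + 1 : ℕ))
  have h3 := Real.sq_sqrt (Nat.cast_nonneg n : (0 : ℝ) ≤ n)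
  rw [div_le_iff₀ (by positivity)]
  push_cast at h1 h2 ⊢
  nlinarith [sq_nonneg (√((n : ℝ) + 1) - √(n : ℝ))]

/-- The linear term of the free energy pays for the expected base loss. The variance term is at most
`C₂ / (2 σ) = √(C₁C₂) / (2 √(n + 1))`, which the decrease of the budget by `√(C₁C₂) (√(n + 1) - √n)`
covers. -/
theorem Entropic.sum_play_mul_energy_le [NeZero A] (hP : P.Entropic) {s : State A}
    (hs : P.Settled s) (ht : s.time < P.T) {l : Fin A → ℝ}
    (hl : ∀ i, l i ∈ Set.Icc (0 : ℝ) 1) :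
    l ⬝ᵥ P.expWeights s +
      ∑ i, P.play s i * P.energy s.start (s.time + 1) (P.nextLoss s i (l i)) ≤
        P.energy s.start s.time (cumLoss s.records) := by
  set σ := P.scale s.start s.time with hσ
  set L := cumLoss s.records with hL
  set w := P.expWeights s with hw
  set p := P.play s with hp
  have hσ0 : 0 < σ := hP.scale_pos s.start ht.le
  have hp0 : ∀ i, 0 < p i := hP.play_pos hs ht
  have hp1 : ∑ i, p i = 1 := (hP.play_mem s).2
  set n := s.time - s.start with hn
  have hn1 : s.time + 1 - s.start = n + 1 := by
    have := hs.start_le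
    omega
  set S := √(P.C₁ * P.C₂) with hS
  have hS0 : 0 ≤ S := Real.sqrt_nonneg _
  have harm : ∀ i, p i * P.energy s.start (s.time + 1) (P.nextLoss s i (l i)) ≤
      p i * (freeEnergy σ L + S * (2 * √((P.T : ℝ) + 1) - √((n + 1 : ℕ) : ℝ))) - l i * w i +
        1 / (2 * σ) * (w i / p i) := by
    intro i
    have hv : 0 ≤ l i / p i := div_nonneg (hl i).1 (hp0 i).le
    have h1 := freeEnergy_le_of_le hσ0 (hP.scale_mono s.start (Nat.le_succ s.time) ht)
      (P.nextLoss s i (l i))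
    have h2 := freeEnergy_add_le hσ0 L (v := Pi.single i (l i / p i)) (by
      intro j
      by_cases hj : j = i
      · rw [hj, Pi.single_eq_same]
        exact hv
      · rw [Pi.single_eq_of_ne hj])
    have h3 : ∑ j, w j * (Pi.single i (l i / p i) : Fin A → ℝ) j ^ 2 = w i * (l i / p i) ^ 2 := by
      rw [Finset.sum_eq_single i]
      · rw [Pi.single_eq_same]
      · intro j _ hj
        rw [Pi.single_eq_of_ne hj]
        ring
      · simp
    have h4 : (softmax fun i => -(L i / σ)) = w := rfl
    rw [h4, dotProduct_single, h3] at h2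
    have h5 := mul_le_mul_of_nonneg_left (h1.trans h2) (hp0 i).le
    have h6 : p i * (freeEnergy σ L - w i * (l i / p i) + 1 / (2 * σ) * (w i * (l i / p i) ^ 2)) =
        p i * freeEnergy σ L - l i * w i + 1 / (2 * σ) * (w i / p i) * l i ^ 2 := by
      have := (hp0 i).ne'
      field_simp
    have h7 : 1 / (2 * σ) * (w i / p i) * l i ^ 2 ≤ 1 / (2 * σ) * (w i / p i) * 1 := by
      refine mul_le_mul_of_nonneg_left (pow_le_one₀ (hl i).1 (hl i).2) ?_
      have := expWeights_pos (P := P) s i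
      have := hp0 i
      positivity
    unfold energy
    rw [hn1, mul_add, mul_add]
    rw [h6] at h5
    linarith
  have hsum := Finset.sum_le_sum fun i (_ : i ∈ Finset.univ) => harm i
  rw [Finset.sum_add_distrib, Finset.sum_sub_distrib, ← Finset.sum_mul, hp1, one_mul,
    ← Finset.mul_sum] at hsum
  have hvar : ∑ i, w i / p i ≤ P.C₂ := by
    rw [hP.C₂_eq]
    have := sum_div_mix_le (aggression_nonneg s.phase hP.regretBudget_pos.le)
      (aggression_le_one s.phase 1) hP.δ_pos hP.mul_δ_le (expWeights_pos (P := P) s)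
      (expWeights_mem (P := P) s).2 hP.le_xc
    rw [hp, hs.play_eq hP.toNoDelay ht]
    exact this
  have hstab : 1 / (2 * σ) * P.C₂ = S * (1 / (2 * √((n + 1 : ℕ) : ℝ))) := by
    have h1 := Real.sqrt_pos.2 hP.C₁_pos
    have h2 := Real.sqrt_pos.2 hP.C₂_pos
    have h3 : 0 < √((n + 1 : ℕ) : ℝ) := Real.sqrt_pos.2 (by positivity)
    rw [hσ, hP.scale_eq s.start ht.le, hS, ← hn, Real.sqrt_div hP.C₂_pos.le,
      Real.sqrt_mul hP.C₁_pos.le]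
    nth_rewrite 2 [← Real.mul_self_sqrt hP.C₂_pos.le]
    field_simp
  have h8 : 1 / (2 * σ) * ∑ i, w i / p i ≤ S * (√((n + 1 : ℕ) : ℝ) - √(n : ℝ)) := by
    refine (mul_le_mul_of_nonneg_left hvar (by positivity)).trans ?_
    rw [hstab]
    exact mul_le_mul_of_nonneg_left (sqrt_add_one_sub_sqrt_ge n) hS0
  have h9 : l ⬝ᵥ w = ∑ i, l i * w i := rfl
  have h10 : P.energy s.start s.time L =
    freeEnergy σ L + S * (2 * √((P.T : ℝ) + 1) - √(n : ℝ)) := rfl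
  rw [h9, h10]
  linarith

/-- The expected regret against the baseline is at most `1`. -/
theorem Entropic.regretAgainst_baseline_le [NeZero A] (hP : P.Entropic)
    {loss : Fin P.T → Fin A → ℝ} (hl : IsLossSeq loss) :
    regretAgainst P.prudentBanker loss P.xc ≤ 1 := by
  have hR := hP.regretBudget_pos
  set Φ : State A → ℝ := fun s => P.aggression s.phase 1 *
    (P.energy s.start s.time (cumLoss s.records) + cumLoss s.records ⬝ᵥ P.xc) with hΦ
  have hstart : ∀ t k, P.aggression k 1 * (P.energy t t (cumLoss []) + cumLoss [] ⬝ᵥ P.xc) ≤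
      2 ^ (k - 1) := by
    intro t k
    rw [show cumLoss ([] : List (Record A)) = 0 from rfl, zero_dotProduct, add_zero]
    exact (mul_le_mul_of_nonneg_left (NoDelay.energy_start_le t)
      (aggression_nonneg k hR.le)).trans (aggression_mul_le k hR)
  have key : regretAgainst (P.learnerFrom (Params.init A)) loss P.xc ≤ Φ (Params.init A) := by
    refine regretAgainst_le_potential P hP.play_mem P.xc P.T P.Settled Φ ?_ ?_ ?_ P.T _
      (settled_init hP.threshold_nonneg) (Nat.zero_add _) loss hl
    · intro s hs ht
      exact mul_nonneg (aggression_nonneg _ hR.le) (hP.energy_add_nonneg ht.le _ hP.xc_mem)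
    · intro s hs ht i l _
      exact hs.step hP.toNoDelay hP.threshold_nonneg ht i l
    · intro s hs ht l hl
      set α := P.aggression s.phase 1 with hα
      have hα0 : 0 ≤ α := aggression_nonneg _ hR.le
      have hnext : ∀ i, Φ (P.step s i (l i)) ≤
          α * (P.energy s.start (s.time + 1) (P.nextLoss s i (l i)) +
            P.nextLoss s i (l i) ⬝ᵥ P.xc) := by
        intro i
        rcases hs.step_cases hP.toNoDelay ht i (l i) with ⟨h, hα1, hgap⟩ | ⟨h, -⟩
        · rw [h]
          refine (hstart _ _).trans ?_
          -- The witness `y` beats the baseline by more than `2 R̂` on the estimates. As the energy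
          -- plus the loss of `y` is nonnegative, the energy plus the loss of the baseline is at
          -- least `2 R̂`.
          obtain ⟨y, hy, hlt⟩ := exists_lt_of_lt_gap hgap
          have h1 := hP.energy_add_nonneg (start := s.start) (t := s.time + 1) ht
            (P.nextLoss s i (l i)) hy
          have h2 := aggression_mul_eq hR hα1
          have h3 : 2 * P.regretBudget 1 ≤
              P.energy s.start (s.time + 1) (P.nextLoss s i (l i)) +
                P.nextLoss s i (l i) ⬝ᵥ P.xc := by
            have := hP.two_mul_le_threshold
            rw [dotProduct_sub] at hlt
            linarith
          have h4 := mul_le_mul_of_nonneg_left h3 hα0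
          have h5 : (2 : ℝ) ^ (s.phase + 1 - 1) = 2 * 2 ^ (s.phase - 1) := by
            rw [← pow_succ']
            congr 1
            have := hs.phase_pos
            omega
          rw [h5, ← h2]
          linarith
        · rw [h, hΦ]
          simp only [cumLoss_newRecords]
          exact le_rfl
      have hsum : ∑ i, P.play s i * Φ (P.step s i (l i)) ≤
          α * (∑ i, P.play s i * P.energy s.start (s.time + 1) (P.nextLoss s i (l i)) +
            (cumLoss s.records ⬝ᵥ P.xc + l ⬝ᵥ P.xc)) := by
        rw [← hP.sum_play_mul_nextLoss hs ht, ← Finset.sum_add_distrib, Finset.mul_sum]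
        refine Finset.sum_le_sum fun i _ => ?_
        refine (mul_le_mul_of_nonneg_left (hnext i) ((hP.play_mem s).1 i)).trans (le_of_eq ?_)
        ring
      have hreg : l ⬝ᵥ (P.play s - P.xc) = α * (l ⬝ᵥ P.expWeights s - l ⬝ᵥ P.xc) := by
        rw [hs.play_eq hP.toNoDelay ht, mix, dotProduct_sub, dotProduct_add, dotProduct_smul,
          dotProduct_smul, smul_eq_mul, smul_eq_mul]
        ring
      have hen := mul_le_mul_of_nonneg_left (hP.sum_play_mul_energy_le hs ht hl) hα0
      rw [hreg, hΦ]
      simp only [← hα]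
      linarith
  refine key.trans ((hstart 0 1).trans (by norm_num))

/-- The expected regret against any strategy, in terms of a bound `K` on the number of phases. -/
theorem Entropic.regretAgainst_le [NeZero A] (hP : P.Entropic) {K : ℕ} (hK1 : 1 ≤ K)
    (hK : P.regretBudget 1 ≤ 2 ^ (K - 1)) {loss : Fin P.T → Fin A → ℝ} (hl : IsLossSeq loss)
    {x : Fin A → ℝ} (hx : x ∈ stdSimplex ℝ (Fin A)) :
    regretAgainst P.prudentBanker loss x ≤ K * (P.regretBudget 1 + P.threshold + 1) := by
  have hR := hP.regretBudget_pos
  have hB := hP.threshold_nonneg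
  set B := P.threshold with hBdef
  set M := P.regretBudget 1 + B + 1 with hM
  -- The terms pay for the base learner, for the baseline while the gap is below the threshold, for
  -- one overshoot of the threshold, and for the phases still to come.
  set Φ : State A → ℝ := fun s => P.aggression s.phase 1 *
    (P.energy s.start s.time (cumLoss s.records) + cumLoss s.records ⬝ᵥ x) +
    (1 - P.aggression s.phase 1) * (B - cumLoss s.records ⬝ᵥ (P.xc - x)) + 1 +
    (K - s.phase) * M with hΦ
  -- A phase that can be restarted has `2 ^ (k - 1) < R̂ ≤ 2 ^ (K - 1)`.
  have hphase : ∀ k, P.aggression k 1 < 1 → k + 1 ≤ K := by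
    intro k hk
    have h1 : (2 : ℝ) ^ (k - 1) < 2 ^ (K - 1) := by
      refine lt_of_lt_of_le ?_ hK
      rw [← aggression_mul_eq hR hk]
      exact mul_lt_of_lt_one_left hR hk
    have h2 := (pow_lt_pow_iff_right₀ (one_lt_two : (1 : ℝ) < 2)).1 h1
    omega
  have hstart : ∀ t k, P.aggression k 1 * (P.energy t t (cumLoss []) + cumLoss [] ⬝ᵥ x) +
      (1 - P.aggression k 1) * (B - cumLoss [] ⬝ᵥ (P.xc - x)) + 1 ≤ M := by
    intro t k
    have h1 := NoDelay.energy_start_le (P := P) t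
    have h2 := aggression_nonneg (P := P) k hR.le
    have h3 := aggression_le_one (P := P) k 1
    rw [show cumLoss ([] : List (Record A)) = 0 from rfl, zero_dotProduct, zero_dotProduct,
      add_zero, sub_zero]
    nlinarith
  have hbase : ∀ s, P.Settled s → 0 ≤ (1 - P.aggression s.phase 1) *
      (B - cumLoss s.records ⬝ᵥ (P.xc - x)) := by
    intro s hs
    rcases (aggression_le_one (P := P) s.phase 1).lt_or_eq with h | h
    · refine mul_nonneg (sub_nonneg.2 h.le) (sub_nonneg.2 ?_)
      exact (le_gap _ hx).trans (hs.gap_le h)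
    · rw [h, sub_self, zero_mul]
  have hM0 : 0 ≤ M := by linarith
  have key : regretAgainst (P.learnerFrom (Params.init A)) loss x ≤ Φ (Params.init A) := by
    refine regretAgainst_le_potential P hP.play_mem x P.T (fun s => P.Settled s ∧ s.phase ≤ K) Φ
      ?_ ?_ ?_ P.T _ ⟨settled_init hB, hK1⟩ (Nat.zero_add _) loss hl
    · rintro s ⟨hs, hsK⟩ ht
      have h1 := mul_nonneg (aggression_nonneg (P := P) s.phase hR.le)
        (hP.energy_add_nonneg (start := s.start) ht.le (cumLoss s.records) hx)
      have h2 := hbase s hs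
      have h3 : 0 ≤ ((K : ℝ) - s.phase) * M :=
        mul_nonneg (sub_nonneg.2 (by exact_mod_cast hsK)) hM0
      simp only [hΦ]
      linarith
    · rintro s ⟨hs, hsK⟩ ht i l _
      refine ⟨hs.step hP.toNoDelay hB ht i l, ?_⟩
      rcases hs.step_cases hP.toNoDelay ht i l with ⟨h, hα1, -⟩ | ⟨h, -⟩
      · rw [h]
        exact hphase _ hα1
      · rw [h]
        exact hsK
    · rintro s ⟨hs, hsK⟩ ht l hl
      set α := P.aggression s.phase 1 with hα
      have hα0 : 0 ≤ α := aggression_nonneg _ hR.le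
      have hα1 : 0 ≤ 1 - α := sub_nonneg.2 (aggression_le_one _ _)
      have hnext : ∀ i, Φ (P.step s i (l i)) ≤
          α * (P.energy s.start (s.time + 1) (P.nextLoss s i (l i)) +
            P.nextLoss s i (l i) ⬝ᵥ x) +
          (1 - α) * (B - P.nextLoss s i (l i) ⬝ᵥ (P.xc - x)) + 1 + (K - s.phase) * M := by
        intro i
        rcases hs.step_cases hP.toNoDelay ht i (l i) with ⟨h, hlt1, -⟩ | ⟨h, -⟩
        · have h1 := mul_nonneg hα0 (hP.energy_add_nonneg (start := s.start) (t := s.time + 1) ht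
            (P.nextLoss s i (l i)) hx)
          have hp0 := hP.play_pos hs ht i
          -- The overshoot in the restarting round: the arm is drawn with probability at least `(1 -
          -- α) * xc i`, which cancels the importance weight.
          have h2 : (1 - α) * (l i / P.play s i * (P.xc i - x i)) ≤ 1 := by
            have h3 : (1 - α) * P.xc i ≤ P.play s i := by
              rw [hs.play_eq hP.toNoDelay ht, mix]
              simp only [Pi.add_apply, Pi.smul_apply, smul_eq_mul]
              have := mul_nonneg hα0 (expWeights_pos (P := P) s i).le
              linarith
            calc (1 - α) * (l i / P.play s i * (P.xc i - x i))
                ≤ (1 - α) * (l i / P.play s i * P.xc i) := by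
                  have := hx.1 i
                  have := div_nonneg (hl i).1 hp0.le
                  gcongr
                  linarith
              _ = l i * ((1 - α) * P.xc i / P.play s i) := by ring
              _ ≤ 1 * 1 := by
                  refine mul_le_mul (hl i).2 ((div_le_one hp0).2 h3) ?_ zero_le_one
                  exact div_nonneg (mul_nonneg hα1 (hP.xc_mem.1 i)) hp0.le
              _ = 1 := one_mul 1
          have h4 := hbase s hs
          have h5 : P.nextLoss s i (l i) ⬝ᵥ (P.xc - x) =
              cumLoss s.records ⬝ᵥ (P.xc - x) + l i / P.play s i * (P.xc i - x i) := by
            rw [nextLoss, add_dotProduct, single_dotProduct]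
            rfl
          have h6 := hstart (s.time + 1) (s.phase + 1)
          rw [h, hΦ]
          simp only
          rw [h5]
          push_cast
          rw [← hα] at h4
          linarith
        · rw [h, hΦ]
          simp only [cumLoss_newRecords]
          exact le_rfl
      have hsum : ∑ i, P.play s i * Φ (P.step s i (l i)) ≤
          α * (∑ i, P.play s i * P.energy s.start (s.time + 1) (P.nextLoss s i (l i)) +
            (cumLoss s.records ⬝ᵥ x + l ⬝ᵥ x)) +
          (1 - α) * (B - (cumLoss s.records ⬝ᵥ (P.xc - x) + l ⬝ᵥ (P.xc - x))) + 1 +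
            (K - s.phase) * M := by
        have e : (1 - α) * B + 1 + (K - s.phase) * M =
            ∑ i, P.play s i * ((1 - α) * B + 1 + (K - s.phase) * M) := by
          rw [← Finset.sum_mul, (hP.play_mem s).2, one_mul]
        have e2 : ∑ i, P.play s i * (α * (P.energy s.start (s.time + 1) (P.nextLoss s i (l i)) +
            P.nextLoss s i (l i) ⬝ᵥ x) +
          (1 - α) * (B - P.nextLoss s i (l i) ⬝ᵥ (P.xc - x)) + 1 + (K - s.phase) * M) =
          α * ∑ i, P.play s i * P.energy s.start (s.time + 1) (P.nextLoss s i (l i)) +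
          α * ∑ i, P.play s i * (P.nextLoss s i (l i) ⬝ᵥ x) -
          (1 - α) * ∑ i, P.play s i * (P.nextLoss s i (l i) ⬝ᵥ (P.xc - x)) +
          ∑ i, P.play s i * ((1 - α) * B + 1 + (K - s.phase) * M) := by
          simp only [Finset.mul_sum, ← Finset.sum_add_distrib, ← Finset.sum_sub_distrib]
          exact Finset.sum_congr rfl fun i _ => by ring
        refine (Finset.sum_le_sum fun i _ => mul_le_mul_of_nonneg_left (hnext i)
          ((hP.play_mem s).1 i)).trans (le_of_eq ?_)
        rw [e2, ← e, hP.sum_play_mul_nextLoss hs ht, hP.sum_play_mul_nextLoss hs ht]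
        ring
      have hreg : l ⬝ᵥ (P.play s - x) = α * (l ⬝ᵥ P.expWeights s - l ⬝ᵥ x) +
          (1 - α) * (l ⬝ᵥ (P.xc - x)) := by
        rw [hs.play_eq hP.toNoDelay ht, mix, dotProduct_sub, dotProduct_sub, dotProduct_add,
          dotProduct_smul, dotProduct_smul, smul_eq_mul, smul_eq_mul]
        ring
      have hen := mul_le_mul_of_nonneg_left (hP.sum_play_mul_energy_le hs ht hl) hα0
      rw [hreg, hΦ]
      simp only [← hα]
      linarith
  refine key.trans ?_
  have := hstart 0 1
  simp only [hΦ, Params.init]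
  push_cast
  linarith

/-- The expected regret is at most the number of rounds. -/
theorem regretAgainst_le_horizon (hP : ∀ s, P.play s ∈ stdSimplex ℝ (Fin A))
    {loss : Fin P.T → Fin A → ℝ} (hl : IsLossSeq loss)
    {x : Fin A → ℝ} (hx : x ∈ stdSimplex ℝ (Fin A)) :
    regretAgainst P.prudentBanker loss x ≤ P.T := by
  have key : regretAgainst (P.learnerFrom (Params.init A)) loss x ≤
      (P.T : ℝ) - ((Params.init A).time : ℝ) := by
    refine regretAgainst_le_potential P hP x P.T (fun _ => True)
      (fun s => (P.T : ℝ) - (s.time : ℝ)) ?_ (fun _ _ _ _ _ _ => trivial) ?_ P.T _ trivial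
      (Nat.zero_add _) loss hl
    · intro s _ ht
      rw [ht, sub_self]
    · intro s _ _ l hl
      have h1 : l ⬝ᵥ (P.play s - x) ≤ 1 := by
        rw [← (hP s).2]
        refine Finset.sum_le_sum fun i _ => ?_
        have := (hP s).1 i
        have := hx.1 i
        have h0 := (hl i).1
        have h1 := (hl i).2
        simp only [Pi.sub_apply]
        nlinarith
      simp only [step_time, ← Finset.sum_mul, (hP s).2]
      push_cast
      linarith
  refine key.trans (le_of_eq ?_)
  simp [Params.init]

end Params
/-! ## The rates -/

/-- The parameters of the entropic algorithm. -/
noncomputable def entropyParams {A : ℕ} (T : ℕ) (δ : ℝ) (xc : Fin A → ℝ) (delay : ℕ → ℕ) :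
    Params A :=
  { Ψ := negEntropy, C₁ := Real.log A, C₂ := 1 / δ, δ := δ, T := T, xc := xc, delay := delay }

theorem entropyPrudentBanker_eq {A : ℕ} (T : ℕ) (δ : ℝ) (xc : Fin A → ℝ) (delay : ℕ → ℕ) :
    entropyPrudentBanker T δ xc delay = (entropyParams T δ xc delay).prudentBanker := rfl

theorem entropic_entropyParams {A T : ℕ} (hA : 2 ≤ A) {δ : ℝ} (hδ : 0 < δ) (hδA : δ ≤ 1 / (A : ℝ))
    {xc : Fin A → ℝ} (hxc : xc ∈ stdSimplex ℝ (Fin A)) (hle : ∀ i, δ ≤ xc i) {delay : ℕ → ℕ}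
    (hd : (∑ t ∈ Finset.range T, delay t) = 0) :
    (entropyParams T δ xc delay).Entropic where
  reg_eq := rfl
  C₁_pos := Real.log_pos (by exact_mod_cast hA)
  C₂_pos := one_div_pos.2 hδ
  delay_eq := fun t ht => Finset.sum_eq_zero_iff.1 hd t (Finset.mem_range.2 ht)
  C₁_eq := rfl
  C₂_eq := rfl
  δ_pos := hδ
  mul_δ_le := by
    have : (0 : ℝ) < A := by exact_mod_cast (by omega : 0 < A)
    rw [le_div_iff₀ this, mul_comm] at hδA
    exact hδA
  xc_mem := hxc
  le_xc := hle

namespace Params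

variable {A : ℕ} {P : Params A}

theorem Entropic.regretBudget_le (hP : P.Entropic) (hT : 1 ≤ P.T) :
    P.regretBudget 1 ≤ 12 * √((P.T : ℝ) * Real.log A / P.δ) := by
  have hT1 : 1 ≤ √(P.T : ℝ) := Real.one_le_sqrt.2 (by exact_mod_cast hT)
  have hlog : √(2 * ((1 : ℕ) : ℝ) * Real.log (((1 : ℕ) : ℝ) + 1)) ≤ 9 / 7 := by
    rw [Nat.cast_one, one_add_one_eq_two]
    refine Real.sqrt_le_iff.2 ⟨by norm_num, ?_⟩
    have := Real.log_two_lt_d9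
    norm_num at this ⊢
    linarith
  have e : √((P.T : ℝ) * Real.log A / P.δ) = √(P.C₁ * P.C₂) * √(P.T : ℝ) := by
    rw [← Real.sqrt_mul (mul_pos hP.C₁_pos hP.C₂_pos).le, hP.C₁_eq, hP.C₂_eq]
    congr 1
    ring
  rw [e, regretBudget]
  generalize √(2 * ((1 : ℕ) : ℝ) * Real.log (((1 : ℕ) : ℝ) + 1)) = r at *
  have := mul_le_mul_of_nonneg_left
    (show 3 * √(P.T : ℝ) + 7 * r ≤ 12 * √(P.T : ℝ) by linarith) (Real.sqrt_nonneg (P.C₁ * P.C₂))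
  linarith

theorem slack_one : P.slack 1 = 2 / P.δ := by
  have : √(8 * ((1 : ℕ) : ℝ) + 1) = 3 := by
    rw [Real.sqrt_eq_iff_mul_self_eq (by positivity) (by norm_num)]
    norm_num
  rw [slack, this]
  norm_num

/-- The constant `12` is rounded up to `16 = 2 ^ 4`, so the number of doublings is at most `4 + 2
log X` before rounding. -/
theorem exists_phase_bound {X R : ℝ} (hX : 1 ≤ X) (hR : R ≤ 12 * X) :
    ∃ K : ℕ, 1 ≤ K ∧ R ≤ 2 ^ (K - 1) ∧ (K : ℝ) ≤ 6 * (1 + Real.log X) := by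
  have hX0 : 0 < X := by linarith
  have hlogX : 0 ≤ Real.log X := Real.log_nonneg hX
  have hlog2 := Real.log_two_gt_d9
  refine ⟨⌈Real.logb 2 (16 * X)⌉₊ + 1, Nat.succ_pos _, ?_, ?_⟩
  · rw [Nat.add_sub_cancel]
    have h := (Real.logb_le_iff_le_rpow one_lt_two (by positivity : 0 < 16 * X)).1
      (Nat.le_ceil (Real.logb 2 (16 * X)))
    rw [Real.rpow_natCast] at h
    linarith
  · have h1 : Real.logb 2 (16 * X) ≤ 4 + 2 * Real.log X := by
      have h16 : Real.log 16 = 4 * Real.log 2 := by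
        rw [show (16 : ℝ) = 2 ^ 4 by norm_num, Real.log_pow]
        norm_num
      rw [Real.logb, Real.log_mul (by norm_num) hX0.ne', h16, div_le_iff₀ (by linarith)]
      norm_num at hlog2
      nlinarith
    have h0 : 0 ≤ Real.logb 2 (16 * X) := Real.logb_nonneg one_lt_two (by linarith)
    have h2 := Nat.ceil_lt_add_one h0
    push_cast
    linarith

theorem Entropic.regret_le [NeZero A] (hP : P.Entropic) (hA : 2 ≤ A) (hT : 1 ≤ P.T)
    {loss : Fin P.T → Fin A → ℝ} (hl : IsLossSeq loss) :
    regret P.prudentBanker loss ≤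
      240 * (1 + Real.log ((A : ℝ) * (P.T : ℝ))) * √((P.T : ℝ) * Real.log A / P.δ) := by
  have hA2 : (2 : ℝ) ≤ A := by exact_mod_cast hA
  have hT1 : (1 : ℝ) ≤ P.T := by exact_mod_cast hT
  have hδ := hP.δ_pos
  have hlogA : 1 / 2 ≤ Real.log A := by
    have h1 := Real.log_two_gt_d9
    have h2 := Real.log_le_log two_pos hA2
    norm_num at h1
    linarith
  have hlogA' : Real.log A ≤ A := (Real.log_le_sub_one_of_pos (by linarith)).trans (by linarith)
  have hAT : (1 : ℝ) ≤ A * P.T := by nlinarith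
  have hℓ : 0 ≤ Real.log ((A : ℝ) * P.T) := Real.log_nonneg hAT
  set ℓ := Real.log ((A : ℝ) * P.T)
  have hδ2 : 2 ≤ 1 / P.δ := by
    rw [le_div_iff₀ hδ]
    nlinarith [hP.mul_δ_le]
  set Q := √((P.T : ℝ) * Real.log A / P.δ) with hQ
  have hQ2 : Q ^ 2 = (P.T * Real.log A) * (1 / P.δ) := by
    rw [hQ, Real.sq_sqrt (by positivity)]
    ring
  have hQ0 : 0 ≤ Q := Real.sqrt_nonneg _
  have hTA : 1 / 2 ≤ P.T * Real.log A := by nlinarith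
  have : Nonempty (stdSimplex ℝ (Fin A)) := ⟨⟨_, hP.xc_mem⟩⟩
  refine ciSup_le fun x => ?_
  -- In the first case `1 / δ ≤ Q`, so the slack `2 / δ` is of the right order and a phase costs at
  -- most `36 Q + 2 Q + Q`. In the second the trivial bound `T ≤ 2 Q` suffices.
  rcases le_or_gt (1 / P.δ) (P.T * Real.log A) with hcase | hcase
  · have hQle : Q ≤ A * P.T := by
      refine (abs_le_of_sq_le_sq' (a := Q) (b := P.T * Real.log A) ?_ (by positivity)).2.trans ?_
      · rw [hQ2, pow_two]
        exact mul_le_mul_of_nonneg_left hcase (by positivity)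
      · nlinarith
    have hδQ : 1 / P.δ ≤ Q := by
      refine (abs_le_of_sq_le_sq' ?_ hQ0).2
      rw [hQ2, pow_two]
      exact mul_le_mul_of_nonneg_right hcase (by positivity)
    have hR := hP.regretBudget_le hT
    rw [← hQ] at hR
    obtain ⟨K, hK1, hK, hKle⟩ := exists_phase_bound hAT (hR.trans (by linarith))
    refine (hP.regretAgainst_le hK1 hK hl x.2).trans ?_
    have hM : P.regretBudget 1 + P.threshold + 1 ≤ 39 * Q := by
      have h2 : 2 / P.δ = 2 * (1 / P.δ) := by ring
      rw [threshold, slack_one, h2]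
      linarith
    calc (K : ℝ) * (P.regretBudget 1 + P.threshold + 1) ≤ 6 * (1 + ℓ) * (39 * Q) :=
          mul_le_mul hKle hM (by linarith [hP.regretBudget_pos, hP.threshold_nonneg])
            (by linarith)
      _ ≤ 240 * (1 + ℓ) * Q := by nlinarith [mul_nonneg hℓ hQ0]
  · refine (regretAgainst_le_horizon hP.play_mem hl x.2).trans ?_
    have hTQ : P.T * Real.log A ≤ Q := by
      refine (abs_le_of_sq_le_sq' ?_ hQ0).2
      rw [hQ2, pow_two]
      exact mul_le_mul_of_nonneg_left hcase.le (by positivity)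
    have : (P.T : ℝ) ≤ 2 * Q := by nlinarith
    nlinarith [mul_nonneg hℓ hQ0]

end Params
end SafeBandit

theorem mainTheorem2 :
    -- the guarantees of Prudent-Banker without delays
    (∃ (C : ℝ) (p : ℕ), ∀ (A T : ℕ), 2 ≤ A → 1 ≤ T →
      ∀ δ : ℝ, 0 < δ → δ ≤ 1 / (A : ℝ) →
      ∀ xc : Fin A → ℝ, xc ∈ stdSimplex ℝ (Fin A) → (∀ i, δ ≤ xc i) →
      ∀ delay : ℕ → ℕ, (∑ t ∈ Finset.range T, delay t) = 0 →
        (SafeBandit.entropyPrudentBanker T δ xc delay).IsValid ∧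
        ∀ loss : Fin T → Fin A → ℝ, SafeBandit.IsLossSeq loss →
          SafeBandit.regret (SafeBandit.entropyPrudentBanker T δ xc delay) loss
              ≤ C * (1 + Real.log ((A : ℝ) * (T : ℝ))) ^ p
                  * √((T : ℝ) * Real.log (A : ℝ) / δ) ∧
          SafeBandit.regret (SafeBandit.entropyPrudentBanker T δ xc delay) loss
              ≤ C * (1 + Real.log ((A : ℝ) * (T : ℝ))) ^ p * √((T : ℝ) / δ) ∧
          SafeBandit.regretAgainst (SafeBandit.entropyPrudentBanker T δ xc delay) loss xc ≤ C) ∧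
    -- the safety-constrained lower bound that they match
    (∃ c C' : ℝ, 0 < c ∧ ∀ (A T : ℕ), 2 ≤ A → 1 ≤ T →
      ∀ δ : ℝ, 1 / (64 * (T : ℝ)) ≤ δ → δ ≤ 1 / (A : ℝ) →
      ∀ Λ : ℝ, 0 ≤ Λ →
      ∃ xc : Fin A → ℝ, xc ∈ stdSimplex ℝ (Fin A) ∧ (∀ i, δ ≤ xc i) ∧
        ∀ L : SafeBandit.Learner A, L.IsValid →
          (∀ loss : Fin T → Fin A → ℝ, SafeBandit.IsLossSeq loss →
            SafeBandit.regretAgainst L loss xc ≤ Λ) →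
          ∃ loss : Fin T → Fin A → ℝ, SafeBandit.IsLossSeq loss ∧
            c * √((T : ℝ) / δ)
                - C' * (√Λ * δ ^ (-(3 / 4) : ℝ) * (T : ℝ) ^ ((1 / 4) : ℝ) + Λ)
              ≤ SafeBandit.regret L loss) := by
  refine ⟨⟨240, 2, fun A T hA hT δ hδ hδA xc hxc hle delay hd => ?_⟩,
    ⟨1 / 100, 2, by norm_num, fun A T hA hT δ h1 h2 Λ hΛ =>
      SafeBandit.exists_loss_regret_ge hA hT h1 h2 hΛ⟩⟩
  have : NeZero A := ⟨by omega⟩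
  have hP := SafeBandit.entropic_entropyParams hA hδ hδA hxc hle hd
  rw [SafeBandit.entropyPrudentBanker_eq]
  refine ⟨fun h => hP.play_mem _, fun loss hl => ?_⟩
  have hreg : SafeBandit.regret (SafeBandit.entropyParams T δ xc delay).prudentBanker loss ≤
      240 * (1 + Real.log ((A : ℝ) * (T : ℝ))) * √((T : ℝ) * Real.log A / δ) :=
    hP.regret_le hA hT hl
  have hA1 : (1 : ℝ) ≤ A := by exact_mod_cast (by omega : 1 ≤ A)
  have hT1 : (1 : ℝ) ≤ T := by exact_mod_cast hT
  have hlogA : Real.log A ≤ Real.log ((A : ℝ) * T) :=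
    Real.log_le_log (by linarith) (le_mul_of_one_le_right (by linarith) hT1)
  have hlogA0 : 0 ≤ Real.log A := Real.log_nonneg hA1
  -- Removing `√(log A)` costs one more logarithmic factor, hence the exponent `2`.
  have hsqrt : √((T : ℝ) * Real.log A / δ) ≤ (1 + Real.log ((A : ℝ) * T)) * √((T : ℝ) / δ) := by
    rw [mul_div_right_comm, mul_comm, Real.sqrt_mul hlogA0]
    refine mul_le_mul_of_nonneg_right (Real.sqrt_le_iff.2 ⟨by linarith, ?_⟩) (Real.sqrt_nonneg _)
    nlinarith
  refine ⟨hreg.trans ?_, hreg.trans ?_, ?_⟩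
  · refine mul_le_mul_of_nonneg_right ?_ (Real.sqrt_nonneg _)
    nlinarith
  · refine (mul_le_mul_of_nonneg_left hsqrt (by linarith)).trans (le_of_eq ?_)
    ring
  · exact (hP.regretAgainst_baseline_le hl).trans (by norm_num)
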